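/- Let $\mathcal C_2$ be the two-dimensional comb lattice: the graph with vertex set $\mathbb Z^2$ in which $(x,y)$ and $(x',y')$ are adjacent if and only if either $x=x'$ and $|y-y'|=1$, or $y=y'=0$ and $|x-x'|=1$. Let $o=(0,0)$ and let $(X^i_t)_{t\ge 0}$, $i=1,2,\dots$, be independent simple random walks on $\mathcal C_2$, defined on a common probability space and all started at $o$ (at each step a walk moves to a uniformly chosen neighbour of its current position). The internal diffusion limited aggregation (IDLA) clusters are defined recursively by $A_1=\{o\}$ and, for $i\ge 2$, $A_i=A_{i-1}\cup\{X^i_{\sigma^i}\}$, where $\sigma^i=\inf\{t\ge 0: X^i_t\notin A_{i-1}\}$ (if $\sigma^i=\infty$, which has probability $0$, put $A_i=A_{i-1}$). Put $$k=\left(\tfrac32\right)^{2/3},\qquad l=\tfrac12\left(\tfrac32\right)^{1/3},$$ and, for real $r\ge 0$, $$\mathcal B_r=\left\{(x,y)\in\mathbb Z^2:\ \frac{|x|}{k}+\left(\frac{|y|}{l}\right)^{1/2}\le r^{1/3}\right\},$$ with $\mathcal B_r=\emptyset$ for $r<0$. Then for every $\varepsilon>0$, with probability $1$, $$\mathcal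 B_{n(1-\varepsilon)}\subset A_n\quad\text{for all sufficiently large } n.$$ -/

import Mathlib

open MeasureTheory ProbabilityTheory Filter

namespace CombIDLA

/-- The two-dimensional comb lattice: the graph on `ℤ × ℤ` with all vertical edges of the square
lattice, and only those horizontal edges that lie on the `x`-axis. -/
def comb : SimpleGraph (ℤ × ℤ) where
  Adj z w := (z.1 = w.1 ∧ |z.2 - w.2| = 1) ∨ (z.2 = 0 ∧ w.2 = 0 ∧ |z.1 - w.1| = 1)
  symm := ⟨fun z w h => by
    rcases h with ⟨h1, h2⟩ | ⟨h1, h2, h3⟩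
    · exact Or.inl ⟨h1.symm, by rwa [abs_sub_comm]⟩
    · exact Or.inr ⟨h2, h1, by rwa [abs_sub_comm]⟩⟩
  loopless := ⟨fun z h => by simp at h⟩

theorem comb_neighborSet_finite (z : ℤ × ℤ) : (comb.neighborSet z).Finite := by
  refine ((Set.finite_Icc (z.1 - 1) (z.1 + 1)).prod
    (Set.finite_Icc (z.2 - 1) (z.2 + 1))).subset ?_
  rintro w (⟨h1, h2⟩ | ⟨h1, h2, h3⟩)
  · have := abs_le.1 h2.le
    simp only [Set.mem_prod, Set.mem_Icc]
    omega
  · have := abs_le.1 h3.le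
    simp only [Set.mem_prod, Set.mem_Icc]
    omega

noncomputable instance : comb.LocallyFinite := fun z => (comb_neighborSet_finite z).fintype

open Classical in
/-- One-step transition probabilities of the simple random walk on the comb. -/
noncomputable def transProb (z w : ℤ × ℤ) : ℝ :=
  if comb.Adj z w then 1 / (comb.degree z : ℝ) else 0

/-- `Y` is (under `μ`) a simple random walk on the comb started at the origin, expressed through
its finite-dimensional distributions: `Y` follows the path `w 0, …, w n` with probability
`1_{w 0 = o} p(w 0, w 1) ⋯ p(w (n-1), w n)`. -/
structure IsSimpleRandomWalk {Ω : Type*} [MeasurableSpace Ω] (μ : Measure Ω)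
    (Y : ℕ → Ω → ℤ × ℤ) : Prop where
  measurable : ∀ t, Measurable (Y t)
  path_prob : ∀ (n : ℕ) (w : ℕ → ℤ × ℤ),
    μ.real {ω | ∀ t ≤ n, Y t ω = w t} =
      if w 0 = (0, 0) then ∏ t ∈ Finset.range n, transProb (w t) (w (t + 1)) else 0

/-- The position at which the trajectory `y` first leaves the set `A`: the set consisting of this
single point if `y` leaves `A`, and the empty set if it never does. -/
def exitPoint (A : Set (ℤ × ℤ)) (y : ℕ → ℤ × ℤ) : Set (ℤ × ℤ) :=
  {z | ∃ t, y t = z ∧ z ∉ A ∧ ∀ s < t, y s ∈ A}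

/-- The IDLA cluster of `n` particles, where `x i` is the trajectory of the particle released after
`i` particles have already settled. Before any particle is released the cluster is empty. -/
def cluster (x : ℕ → ℕ → ℤ × ℤ) : ℕ → Set (ℤ × ℤ)
  | 0 => ∅
  | n + 1 => cluster x n ∪ exitPoint (cluster x n) (x n)

/-- The first particle settles at its starting point. -/
theorem cluster_one (x : ℕ → ℕ → ℤ × ℤ) (h : x 0 0 = (0, 0)) : cluster x 1 = {(0, 0)} := by
  ext z
  simp only [cluster, exitPoint, Set.empty_union, Set.mem_ofPred_eq, Set.mem_singleton_iff,
    Set.mem_empty_iff_false, not_false_eq_true, true_and]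
  constructor
  · rintro ⟨t, rfl, ht⟩
    rcases Nat.eq_zero_or_pos t with rfl | h0
    · exact h
    · exact (ht 0 h0).elim
  · rintro rfl
    exact ⟨0, h, fun s hs => absurd hs (Nat.not_lt_zero s)⟩

/-- The constant `k = (3/2)^(2/3)`. -/
noncomputable def k : ℝ := (3 / 2 : ℝ) ^ (2 / 3 : ℝ)

/-- The constant `l = (1/2) (3/2)^(1/3)`. -/
noncomputable def l : ℝ := 1 / 2 * (3 / 2 : ℝ) ^ (1 / 3 : ℝ)

/-- The set of all `(x, y)` with `|x| / k + (|y| / l)^(1/2) ≤ r^(1/3)`. It is empty for `r < 0`; the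
condition `0 ≤ r` says so explicitly because `Real.rpow` at a negative base is not the real cube
root. -/
def ball (r : ℝ) : Set (ℤ × ℤ) :=
  {z | 0 ≤ r ∧ |(z.1 : ℝ)| / k + (|(z.2 : ℝ)| / l) ^ (1 / 2 : ℝ) ≤ r ^ (1 / 3 : ℝ)}

end CombIDLA

namespace CombIDLA

/-! Fix a site z of a finite set B, and let H(v) be the probability that a walk from v hits z before
leaving B. Stop each walk when it leaves the part of the current cluster lying in B \ {z}. The value
of H at the stopping point has mean at least H(o), so n walks should collect about n H(o). While z
stays out of the cluster, every walk stopped inside B settles there on a fresh site, so the amount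
collected is at most ∑_B H (`sum_exitValue_le`). If ∑_B H ≤ n H(o) - r, a Chernoff bound gives P(z ∉
A_n) ≤ exp(-r²/4n) (`measure_notMem_cluster_le`).

The deficit r comes from a divisible sandpile. The function u = `odometer M` vanishes off B =
`region M` and satisfies Δu ≥ 1 - n δ_o on B once n ≥ 4M³/9 + 7M². Green's identity against H yields
∑_B H ≤ n H(o) + u(z) ΔH(z), and ΔH(z) ≤ -1/(M² + M) because H must fall from 1 to 0 along the tooth
of z (`IsHittingFunction.lap_self_le`, `IsHittingFunction.sum_le`).

In the continuum u = (L - |y|)²/2 on a tooth of half-length L, and balance on the axis, (L²/2)'' =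
2L, gives L = (M - |x|)²/3. The enclosed area is 4M³/9, and the boundary |x| + √(3|y|) = M is that
of the ball when M = k n^(1/3). Well inside, u(z) is of order M⁴, so r is of order M² while n is of
order M³. The failure probability exp(-cM) beats the polynomial number of sites, and Borel–Cantelli
concludes. -/

/-! ### The graph Laplacian, the maximum principle and the Dirichlet problem. -/

theorem neighborFinset_comb (x y : ℤ) :
    comb.neighborFinset (x, y) =
      if y = 0 then {(x, y + 1), (x, y - 1), (x + 1, y), (x - 1, y)}
      else {(x, y + 1), (x, y - 1)} := by
  ext ⟨a, b⟩
  rw [SimpleGraph.mem_neighborFinset]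
  split_ifs with h <;>
    simp only [comb, Finset.mem_insert, Finset.mem_singleton, Prod.mk.injEq,
      abs_eq (zero_le_one' ℤ)] <;> omega

/-- The (unnormalised) graph Laplacian of the comb. -/
noncomputable def lap (f : ℤ × ℤ → ℝ) (v : ℤ × ℤ) : ℝ :=
  ∑ w ∈ comb.neighborFinset v, (f w - f v)

theorem sum_neighborFinset (f : ℤ × ℤ → ℝ) (x y : ℤ) :
    ∑ w ∈ comb.neighborFinset (x, y), f w = f (x, y + 1) + f (x, y - 1) +
      if y = 0 then f (x + 1, y) + f (x - 1, y) else 0 := by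
  rw [neighborFinset_comb]
  split_ifs with h
  · rw [Finset.sum_insert, Finset.sum_insert, Finset.sum_insert, Finset.sum_singleton]
    · ring
    all_goals simp only [Finset.mem_insert, Finset.mem_singleton, Prod.mk.injEq]; omega
  · rw [Finset.sum_insert, Finset.sum_singleton]
    · ring
    all_goals simp only [Finset.mem_singleton, Prod.mk.injEq]; omega

theorem lap_eq (f : ℤ × ℤ → ℝ) (x y : ℤ) :
    lap f (x, y) = f (x, y + 1) + f (x, y - 1) - 2 * f (x, y) +
      if y = 0 then f (x + 1, y) + f (x - 1, y) - 2 * f (x, y) else 0 := by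
  rw [lap, sum_neighborFinset (fun w => f w - f (x, y))]
  split_ifs <;> ring

theorem degree_pos (v : ℤ × ℤ) : 0 < comb.degree v := by
  obtain ⟨x, y⟩ := v
  rw [SimpleGraph.degree_pos_iff_exists_adj]
  exact ⟨(x, y + 1), Or.inl ⟨rfl, by simp⟩⟩

/-- The maximum principle on a finite set. -/
theorem nonpos_of_lap_nonneg (D : Finset (ℤ × ℤ)) (f : ℤ × ℤ → ℝ)
    (hD : ∀ v ∈ D, 0 ≤ lap f v) (hf : ∀ v ∉ D, f v ≤ 0) (v : ℤ × ℤ) : f v ≤ 0 := by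
  by_contra! hv
  have hvD : v ∈ D := by
    by_contra h
    exact absurd (hf v h) (not_le.2 hv)
  obtain ⟨m, hmD, hm⟩ := D.exists_max_image f ⟨v, hvD⟩
  have hm0 : 0 < f m := hv.trans_le (hm v hvD)
  have hle : ∀ w, f w ≤ f m := fun w => by
    by_cases hw : w ∈ D
    · exact hm w hw
    · exact (hf w hw).trans hm0.le
  -- Take a topmost maximiser: the Laplacian inequality forces the site above it to be a maximiser
  -- too, so no connectivity argument is needed.
  obtain ⟨⟨x, y⟩, hp, hmax⟩ := (D.filter fun w => f w = f m).exists_max_image Prod.snd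
    ⟨m, by simp [hmD]⟩
  rw [Finset.mem_filter] at hp
  have h1 := hD _ hp.1
  rw [lap_eq, hp.2] at h1
  have h2 : f (x, y + 1) = f m := by
    have a := hle (x, y + 1)
    have b := hle (x, y - 1)
    have c := hle (x + 1, y)
    have d := hle (x - 1, y)
    split_ifs at h1 <;> linarith
  have h3 : (x, y + 1) ∈ D := by
    by_contra h
    have := hf _ h
    linarith
  have := hmax (x, y + 1) (Finset.mem_filter.2 ⟨h3, h2⟩)
  simp at this

theorem lap_add (f g : ℤ × ℤ → ℝ) (v : ℤ × ℤ) : lap (f + g) v = lap f v + lap g v := by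
  simp only [lap, ← Finset.sum_add_distrib, Pi.add_apply]
  exact Finset.sum_congr rfl fun w _ => by ring

theorem lap_smul (c : ℝ) (f : ℤ × ℤ → ℝ) (v : ℤ × ℤ) : lap (c • f) v = c * lap f v := by
  simp only [lap, Finset.mul_sum, Pi.smul_apply, smul_eq_mul]
  exact Finset.sum_congr rfl fun w _ => by ring

theorem lap_neg (f : ℤ × ℤ → ℝ) (v : ℤ × ℤ) : lap (-f) v = -lap f v := by
  simpa using lap_smul (-1) f v

theorem lap_sub_const (f : ℤ × ℤ → ℝ) (c : ℝ) (v : ℤ × ℤ) :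
    lap (fun w => f w - c) v = lap f v := by
  simp [lap]

/-- Extension by zero of a function on a finite set. -/
def extendZero (D : Finset (ℤ × ℤ)) : (D → ℝ) →ₗ[ℝ] (ℤ × ℤ → ℝ) where
  toFun f v := if h : v ∈ D then f ⟨v, h⟩ else 0
  map_add' f g := by ext v; by_cases h : v ∈ D <;> simp [h]
  map_smul' c f := by ext v; by_cases h : v ∈ D <;> simp [h]

theorem extendZero_of_notMem {D : Finset (ℤ × ℤ)} (f : D → ℝ) {v : ℤ × ℤ} (h : v ∉ D) :
    extendZero D f v = 0 := by
  simp [extendZero, h]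

/-- Solvability of the Dirichlet problem on a finite set. -/
theorem exists_lap_eq (D : Finset (ℤ × ℤ)) (g : ℤ × ℤ → ℝ) :
    ∃ f : ℤ × ℤ → ℝ, (∀ v ∉ D, f v = 0) ∧ ∀ v ∈ D, lap f v = g v := by
  let T : (D → ℝ) →ₗ[ℝ] (D → ℝ) :=
    { toFun := fun f v => lap (extendZero D f) v
      map_add' := fun f g => by ext v; simp [lap_add]
      map_smul' := fun c f => by ext v; simp [lap_smul] }
  -- Uniqueness follows from the maximum principle applied to f and -f; in finite dimension it gives
  -- existence.
  have hT : Function.Injective T := by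
    rw [injective_iff_map_eq_zero]
    intro f hf
    have h0 : ∀ v ∈ D, lap (extendZero D f) v = 0 := fun v hv => congr_fun hf ⟨v, hv⟩
    have h1 := nonpos_of_lap_nonneg D (extendZero D f) (fun v hv => (h0 v hv).ge)
      (fun v hv => (extendZero_of_notMem f hv).le)
    have h2 := nonpos_of_lap_nonneg D (-extendZero D f)
      (fun v hv => by rw [lap_neg, h0 v hv, neg_zero])
      (fun v hv => by simp [extendZero_of_notMem f hv])
    ext v
    have h3 : extendZero D f v = f v := by simp [extendZero]
    have h4 := h2 v
    rw [Pi.neg_apply] at h4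
    rw [Pi.zero_apply, ← h3]
    exact le_antisymm (h1 v) (by linarith)
  obtain ⟨f, hf⟩ := LinearMap.injective_iff_surjective.1 hT (fun v => g v)
  exact ⟨extendZero D f, fun v hv => extendZero_of_notMem f hv, fun v hv => congr_fun hf ⟨v, hv⟩⟩

/-! ### Hitting functions and Green's identity. -/

/-- `H` has the properties of the probability of hitting `z` before leaving `B`. -/
structure IsHittingFunction (B : Finset (ℤ × ℤ)) (z : ℤ × ℤ) (H : ℤ × ℤ → ℝ) : Prop where
  apply_self : H z = 1
  apply_of_notMem : ∀ v ∉ B, H v = 0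
  lap_eq_zero : ∀ v ∈ B, v ≠ z → lap H v = 0
  nonneg : ∀ v, 0 ≤ H v
  le_one : ∀ v, H v ≤ 1

theorem exists_isHittingFunction {B : Finset (ℤ × ℤ)} {z : ℤ × ℤ} (hz : z ∈ B) :
    ∃ H, IsHittingFunction B z H := by
  -- Subtracting the indicator of z turns the boundary value 1 at z into a source term with zero
  -- boundary data.
  obtain ⟨f, hf0, hf⟩ := exists_lap_eq (B.erase z) (-lap (Pi.single z 1))
  set H : ℤ × ℤ → ℝ := f + Pi.single z 1 with hH
  have hHz : H z = 1 := by simp [hH, hf0 z]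
  have hHn : ∀ v ∉ B, H v = 0 := fun v hv => by
    have hvz : v ≠ z := fun h => hv (h ▸ hz)
    simp [hH, hf0 v (fun h => hv (Finset.mem_of_mem_erase h)), hvz]
  have hHl : ∀ v ∈ B.erase z, lap H v = 0 := fun v hv => by
    rw [hH, lap_add, hf v hv, Pi.neg_apply, neg_add_cancel]
  have hout : ∀ v ∉ B.erase z, H v = 0 ∨ H v = 1 := fun v hv => by
    by_cases h : v = z
    · exact Or.inr (h ▸ hHz)
    · exact Or.inl (hHn v fun hb => hv (Finset.mem_erase.2 ⟨h, hb⟩))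
  refine ⟨H, hHz, hHn, fun v hv hvz => hHl v (Finset.mem_erase.2 ⟨hvz, hv⟩), fun v => ?_,
    fun v => ?_⟩
  · have := nonpos_of_lap_nonneg (B.erase z) (-H) (fun v hv => by rw [lap_neg, hHl v hv, neg_zero])
      (fun v hv => by rcases hout v hv with h | h <;> simp [h]) v
    rw [Pi.neg_apply] at this
    linarith
  · have := nonpos_of_lap_nonneg (B.erase z) (fun w => H w - 1)
      (fun v hv => by rw [lap_sub_const, hHl v hv])
      (fun v hv => by rcases hout v hv with h | h <;> simp [h]) v
    simpa using this

/-- Green's identity for functions supported in a finite set. -/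
theorem sum_mul_lap_comm (B : Finset (ℤ × ℤ)) (f g : ℤ × ℤ → ℝ) (hf : ∀ v ∉ B, f v = 0)
    (hg : ∀ v ∉ B, g v = 0) : ∑ v ∈ B, f v * lap g v = ∑ v ∈ B, g v * lap f v := by
  classical
  -- Neighbours outside B contribute nothing, since f and g both vanish there; what remains is an
  -- antisymmetric kernel on B × B.
  have key : ∀ v, f v * lap g v - g v * lap f v =
      ∑ w ∈ B, if comb.Adj v w then f v * g w - g v * f w else 0 := fun v => by
    rw [← Finset.sum_filter, lap, lap, Finset.mul_sum, Finset.mul_sum, ← Finset.sum_sub_distrib]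
    have : ∀ w, f v * (g w - g v) - g v * (f w - f v) = f v * g w - g v * f w := fun w => by ring
    simp only [this]
    symm
    apply Finset.sum_subset
    · intro w hw
      rw [SimpleGraph.mem_neighborFinset]
      exact (Finset.mem_filter.1 hw).2
    · intro w hw hw'
      have hwB : w ∉ B := fun h =>
        hw' (Finset.mem_filter.2 ⟨h, (SimpleGraph.mem_neighborFinset _ _ _).1 hw⟩)
      rw [hf w hwB, hg w hwB]; ring
  have h1 : ∑ v ∈ B, (f v * lap g v - g v * lap f v) =
      -∑ v ∈ B, (f v * lap g v - g v * lap f v) := by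
    simp only [key]
    conv_lhs => rw [Finset.sum_comm]
    rw [← Finset.sum_neg_distrib]
    refine Finset.sum_congr rfl fun v _ => ?_
    rw [← Finset.sum_neg_distrib]
    refine Finset.sum_congr rfl fun w _ => ?_
    simp only [comb.adj_comm w v]
    split_ifs <;> ring
  rw [Finset.sum_sub_distrib] at h1
  linarith

/-- Upper bound for the Laplacian of a hitting function at its pole, in terms of the distance
`d` to the end of the tooth. -/
theorem IsHittingFunction.lap_self_le {B : Finset (ℤ × ℤ)} {x y : ℤ} {H : ℤ × ℤ → ℝ}
    (hH : IsHittingFunction B (x, y) H) {d : ℕ} (hd : 0 < d)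
    (hB : ∀ v ∈ B, v.1 = x → |v.2| < d) : lap H (x, y) ≤ -(1 / d) := by
  -- `e` is the direction pointing away from the axis
  obtain ⟨e, he, hey⟩ : ∃ e : ℤ, (e = 1 ∨ e = -1) ∧ 0 ≤ e * y := by
    rcases le_total 0 y with h | h
    · exact ⟨1, by simp, by simpa⟩
    · exact ⟨-1, by simp, by simpa⟩
  set a : ℕ → ℝ := fun j => H (x, y + e * j) with ha
  -- Moving away from the axis, H is convex: harmonic inside B, and at a site outside B the middle
  -- value is 0 while the outer ones are nonnegative.
  have hconv : ∀ j : ℕ, a (j + 1) - a j ≤ a (j + 2) - a (j + 1) := fun j => by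
    have h0 := hH.nonneg (x, y + e * j)
    have h2 := hH.nonneg (x, y + e * (j + 2))
    by_cases hm : (x, y + e * (j + 1)) ∈ B
    · have hy0 : y + e * (j + 1) ≠ 0 := by
        intro h
        rcases he with rfl | rfl <;> omega
      have h1 := hH.lap_eq_zero _ hm (by
        intro h
        rw [Prod.mk.injEq] at h
        rcases he with rfl | rfl <;> omega)
      rw [lap_eq, if_neg hy0] at h1
      simp only [ha]
      push_cast
      rcases he with rfl | rfl
      · rw [show y + 1 * ((j : ℤ) + 1) + 1 = y + 1 * ((j : ℤ) + 2) by ring,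
          show y + 1 * ((j : ℤ) + 1) - 1 = y + 1 * (j : ℤ) by ring] at h1
        linarith
      · rw [show y + -1 * ((j : ℤ) + 1) - 1 = y + -1 * ((j : ℤ) + 2) by ring,
          show y + -1 * ((j : ℤ) + 1) + 1 = y + -1 * (j : ℤ) by ring] at h1
        linarith
    · have h1 := hH.apply_of_notMem _ hm
      simp only [ha]
      push_cast
      linarith
  have hdiff : ∀ j : ℕ, a 1 - a 0 ≤ a (j + 1) - a j := fun j => by
    induction j with
    | zero => simp
    | succ j ih => exact ih.trans (hconv j)
  have hlin : ∀ j : ℕ, a 0 + j * (a 1 - a 0) ≤ a j := fun j => by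
    induction j with
    | zero => simp
    | succ j ih =>
      have := hdiff j
      push_cast
      linarith
  have ha0 : a 0 = 1 := by simp [ha, hH.apply_self]
  have had : a d = 0 := by
    refine hH.apply_of_notMem _ fun h => ?_
    have := abs_lt.1 (hB _ h rfl)
    rcases he with rfl | rfl <;> simp only at this <;> omega
  have h3 := hlin d
  rw [ha0, had] at h3
  have hd' : (0 : ℝ) < d := by exact_mod_cast hd
  have h4 : a 1 - 1 ≤ -(1 / d) := by
    rw [← neg_div, le_div_iff₀ hd']
    linarith
  have h5 : lap H (x, y) ≤ a 1 - 1 := by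
    rw [lap_eq, hH.apply_self]
    have h1 := hH.le_one (x, y + 1)
    have h2 := hH.le_one (x, y - 1)
    have h3 := hH.le_one (x + 1, y)
    have h4 := hH.le_one (x - 1, y)
    rcases he with rfl | rfl
    · have : a 1 = H (x, y + 1) := by simp [ha]
      split_ifs <;> linarith
    · have : a 1 = H (x, y - 1) := by simp [ha, sub_eq_add_neg]
      split_ifs <;> linarith
  exact h5.trans h4

/-! ### A single walk: Markov property and exit from a finite set. -/

theorem transProb_nonneg (v w : ℤ × ℤ) : 0 ≤ transProb v w := by
  unfold transProb
  split_ifs <;> positivity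

/-- Averaging over one step of the walk. -/
theorem sum_transProb_mul (B : Finset (ℤ × ℤ)) (f : ℤ × ℤ → ℝ) (hf : ∀ w ∉ B, f w = 0)
    (v : ℤ × ℤ) : ∑ w ∈ B, transProb v w * f w = f v + lap f v / comb.degree v := by
  classical
  have hd : (comb.degree v : ℝ) ≠ 0 := by exact_mod_cast (degree_pos v).ne'
  have h1 : ∑ w ∈ B, transProb v w * f w = (∑ w ∈ comb.neighborFinset v, f w) / comb.degree v := by
    rw [Finset.sum_div]
    have : ∀ w, transProb v w * f w = if comb.Adj v w then f w / comb.degree v else 0 := fun w => by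
      unfold transProb
      split_ifs <;> ring
    simp only [this]
    rw [← Finset.sum_filter]
    apply Finset.sum_subset
    · intro w hw
      rw [SimpleGraph.mem_neighborFinset]
      exact (Finset.mem_filter.1 hw).2
    · intro w hw hw'
      rw [hf w fun h => hw' (Finset.mem_filter.2 ⟨h, (SimpleGraph.mem_neighborFinset _ _ _).1 hw⟩),
        zero_div]
  rw [h1, lap, Finset.sum_sub_distrib, Finset.sum_const, SimpleGraph.card_neighborFinset_eq_degree,
    nsmul_eq_mul]
  field_simp
  ring

theorem measurableSet_exitPoint {Ω : Type*} {m : MeasurableSpace Ω} {Y : ℕ → Ω → ℤ × ℤ}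
    (hY : ∀ t, Measurable (Y t)) {A : Ω → Set (ℤ × ℤ)}
    (hA : ∀ v, MeasurableSet {ω | v ∈ A ω}) (v : ℤ × ℤ) :
    MeasurableSet {ω | v ∈ exitPoint (A ω) (fun t => Y t ω)} := by
  have hmem : ∀ t, MeasurableSet {ω | Y t ω ∈ A ω} := fun t => by
    have : {ω | Y t ω ∈ A ω} = ⋃ w : ℤ × ℤ, {ω | Y t ω = w} ∩ {ω | w ∈ A ω} := by
      ext ω; simp
    rw [this]
    exact MeasurableSet.iUnion fun w => (hY t (measurableSet_singleton w)).inter (hA w)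
  have : {ω | v ∈ exitPoint (A ω) (fun t => Y t ω)} =
      ⋃ t : ℕ, {ω | Y t ω = v} ∩ ({ω | v ∈ A ω}ᶜ ∩ ⋂ s : ℕ, ⋂ _ : s < t, {ω | Y s ω ∈ A ω}) := by
    ext ω
    simp [exitPoint]
  rw [this]
  exact MeasurableSet.iUnion fun t => (hY t (measurableSet_singleton v)).inter
    ((hA v).compl.inter (MeasurableSet.iInter fun s => MeasurableSet.iInter fun _ => hmem s))

namespace IsSimpleRandomWalk

variable {Ω : Type*} [MeasurableSpace Ω] {μ : Measure Ω}
  {Y : ℕ → Ω → ℤ × ℤ}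

theorem measurableSet_stay (hY : IsSimpleRandomWalk μ Y) (D : Set (ℤ × ℤ)) (t : ℕ) :
    MeasurableSet {ω | ∀ s < t, Y s ω ∈ D} := by
  have : {ω | ∀ s < t, Y s ω ∈ D} = ⋂ s : ℕ, ⋂ _ : s < t, Y s ⁻¹' D := by ext ω; simp
  rw [this]
  exact MeasurableSet.iInter fun s => MeasurableSet.iInter fun _ =>
    hY.measurable s (Set.to_countable D).measurableSet

/-- The sub-probability mass function of the position at time `t` of the walk killed on leaving
`D` before time `t`. -/
noncomputable def killed (μ : Measure Ω) (Y : ℕ → Ω → ℤ × ℤ) (D : Finset (ℤ × ℤ)) (t : ℕ)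
    (w : ℤ × ℤ) : ℝ :=
  μ.real {ω | (∀ s < t, Y s ω ∈ D) ∧ Y t ω = w}

theorem killed_nonneg (D : Finset (ℤ × ℤ)) (t : ℕ) (w : ℤ × ℤ) : 0 ≤ killed μ Y D t w :=
  measureReal_nonneg

theorem killed_zero (hY : IsSimpleRandomWalk μ Y) (D : Finset (ℤ × ℤ)) (w : ℤ × ℤ) :
    killed μ Y D 0 w = if w = (0, 0) then 1 else 0 := by
  have := hY.path_prob 0 (fun _ => w)
  simpa [killed] using this

variable [IsProbabilityMeasure μ]

/-- The Markov property at a fixed time. -/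
theorem markov (hY : IsSimpleRandomWalk μ Y) (D : Set (ℤ × ℤ)) (t : ℕ) (v w : ℤ × ℤ) :
    μ.real {ω | (∀ s < t, Y s ω ∈ D) ∧ Y t ω = v ∧ Y (t + 1) ω = w} =
      μ.real {ω | (∀ s < t, Y s ω ∈ D) ∧ Y t ω = v} * transProb v w := by
  let T : Ω → (Fin t → ℤ × ℤ) := fun ω s => Y s ω
  have hT : Measurable T := measurable_pi_lambda _ fun s => hY.measurable s
  have hv : MeasurableSet {ω | Y t ω = v} := hY.measurable t (measurableSet_singleton v)
  have hw : MeasurableSet {ω | Y (t + 1) ω = w} := hY.measurable _ (measurableSet_singleton w)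
  have hext : (μ.restrict ({ω | Y t ω = v} ∩ {ω | Y (t + 1) ω = w})).map T =
      ENNReal.ofReal (transProb v w) • (μ.restrict {ω | Y t ω = v}).map T := by
    -- The space of paths of length t is countable, so comparing single paths suffices, and there
    -- the path probabilities differ by one factor.
    refine Measure.ext_of_singleton fun p => ?_
    have hp : MeasurableSet (T ⁻¹' {p}) := hT (measurableSet_singleton p)
    let path : ℕ → ℤ × ℤ := fun s => if h : s < t then p ⟨s, h⟩ else if s = t then v else w
    have hpath : ∀ s (h : s < t), path s = p ⟨s, h⟩ := fun s h => by simp [path, h]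
    have hpt : path t = v := by simp [path]
    have hpt1 : path (t + 1) = w := by simp [path]
    have e1 : T ⁻¹' {p} ∩ {ω | Y t ω = v} = {ω | ∀ s ≤ t, Y s ω = path s} := by
      ext ω
      simp only [Set.mem_inter_iff, Set.mem_preimage, Set.mem_singleton_iff, Set.mem_ofPred_eq]
      constructor
      · rintro ⟨h1, h2⟩ s hs
        rcases hs.lt_or_eq with h | rfl
        · rw [hpath s h, ← h1]
        · rw [hpt, h2]
      · intro h
        refine ⟨funext fun s => ?_, by rw [h t le_rfl, hpt]⟩
        exact (h s s.2.le).trans (hpath s s.2)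
    have e2 : T ⁻¹' {p} ∩ ({ω | Y t ω = v} ∩ {ω | Y (t + 1) ω = w}) =
        {ω | ∀ s ≤ t + 1, Y s ω = path s} := by
      rw [← Set.inter_assoc, e1]
      ext ω
      simp only [Set.mem_inter_iff, Set.mem_ofPred_eq]
      constructor
      · rintro ⟨h1, h2⟩ s hs
        rcases hs.lt_or_eq with h | rfl
        · exact h1 s (by omega)
        · rw [hpt1, h2]
      · intro h
        exact ⟨fun s hs => h s (by omega), by rw [h _ le_rfl, hpt1]⟩
    have e3 : μ.real {ω | ∀ s ≤ t + 1, Y s ω = path s} =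
        transProb v w * μ.real {ω | ∀ s ≤ t, Y s ω = path s} := by
      rw [hY.path_prob, hY.path_prob]
      split_ifs
      · rw [Finset.prod_range_succ, hpt, hpt1, mul_comm]
      · simp
    rw [Measure.map_apply hT (measurableSet_singleton p), Measure.restrict_apply hp,
      Measure.smul_apply, Measure.map_apply hT (measurableSet_singleton p),
      Measure.restrict_apply hp, e1, e2, ← ofReal_measureReal, e3,
      ENNReal.ofReal_mul (transProb_nonneg v w), ofReal_measureReal, smul_eq_mul]
  have hS : MeasurableSet {p : Fin t → ℤ × ℤ | ∀ s, p s ∈ D} :=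
    (Set.to_countable _).measurableSet
  have h1 := congrArg (fun ν : Measure (Fin t → ℤ × ℤ) => ν {p | ∀ s, p s ∈ D}) hext
  simp only [Measure.smul_apply, smul_eq_mul] at h1
  rw [Measure.map_apply hT hS, Measure.map_apply hT hS, Measure.restrict_apply (hT hS),
    Measure.restrict_apply (hT hS)] at h1
  have e0 : T ⁻¹' {p : Fin t → ℤ × ℤ | ∀ s, p s ∈ D} = {ω | ∀ s < t, Y s ω ∈ D} := by
    ext ω
    simp only [Set.mem_preimage, Set.mem_ofPred_eq, T]
    exact ⟨fun h s hs => h ⟨s, hs⟩, fun h s => h s s.2⟩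
  rw [e0] at h1
  have h2 := congrArg ENNReal.toReal h1
  rw [ENNReal.toReal_mul, ENNReal.toReal_ofReal (transProb_nonneg v w), mul_comm] at h2
  exact h2

theorem killed_succ (hY : IsSimpleRandomWalk μ Y) (D : Finset (ℤ × ℤ)) (t : ℕ) (w : ℤ × ℤ) :
    killed μ Y D (t + 1) w = ∑ v ∈ D, killed μ Y D t v * transProb v w := by
  have e : {ω | (∀ s < t + 1, Y s ω ∈ D) ∧ Y (t + 1) ω = w} =
      ⋃ v ∈ D, {ω | (∀ s < t, Y s ω ∈ (D : Set (ℤ × ℤ))) ∧ Y t ω = v ∧ Y (t + 1) ω = w} := by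
    ext ω
    simp only [Set.mem_ofPred_eq, Set.mem_iUnion, Finset.mem_coe, exists_prop]
    constructor
    · rintro ⟨h1, h2⟩
      exact ⟨Y t ω, h1 t (Nat.lt_succ_self t), fun s hs => h1 s (by omega), rfl, h2⟩
    · rintro ⟨v, hv, h1, h2, h3⟩
      refine ⟨fun s hs => ?_, h3⟩
      rcases (Nat.lt_succ_iff.1 hs).lt_or_eq with h | rfl
      · exact h1 s h
      · rwa [h2]
  rw [killed, e, measureReal_biUnion_finset]
  · exact Finset.sum_congr rfl fun v _ => hY.markov D t v w
  · intro v _ v' _ hne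
    refine Set.disjoint_left.2 fun ω h h' => hne ?_
    exact h.2.1.symm.trans h'.2.1
  · intro v _
    exact (hY.measurableSet_stay D t).inter ((hY.measurable t (measurableSet_singleton v)).inter
      (hY.measurable (t + 1) (measurableSet_singleton w)))

/-- One step of a function supported in a finite set along the killed walk. -/
theorem sum_killed_succ (hY : IsSimpleRandomWalk μ Y) (D B : Finset (ℤ × ℤ)) (f : ℤ × ℤ → ℝ)
    (hf : ∀ w ∉ B, f w = 0) (t : ℕ) :
    ∑ w ∈ B, killed μ Y D (t + 1) w * f w =
      ∑ v ∈ D, killed μ Y D t v * (f v + lap f v / comb.degree v) := by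
  simp only [hY.killed_succ, Finset.sum_mul]
  rw [Finset.sum_comm]
  refine Finset.sum_congr rfl fun v _ => ?_
  rw [← sum_transProb_mul B f hf v, Finset.mul_sum]
  exact Finset.sum_congr rfl fun w _ => by ring

/-- The walk leaves every finite set. -/
theorem tendsto_sum_killed (hY : IsSimpleRandomWalk μ Y) (D : Finset (ℤ × ℤ)) :
    Tendsto (fun t => ∑ w ∈ D, killed μ Y D t w) atTop (nhds 0) := by
  classical
  set B := D ∪ D.biUnion fun v => comb.neighborFinset v with hB
  -- The Laplacian of F equals the degree, so the mean of C - F drops by one per step still spent in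
  -- D. Being nonnegative, it bounds the expected time in D.
  let F : ℤ × ℤ → ℝ := fun w => (w.1 : ℝ) ^ 2 + (w.2 : ℝ) ^ 2
  obtain ⟨C, hC⟩ := (B.image F).bddAbove
  have hC' : ∀ w ∈ B, F w ≤ C := fun w hw => hC (Finset.mem_coe.2 (Finset.mem_image_of_mem F hw))
  let g : ℤ × ℤ → ℝ := fun w => if w ∈ B then C - F w else 0
  have hg0 : ∀ w, 0 ≤ g w := fun w => by
    simp only [g]
    split_ifs with h
    · linarith [hC' w h]
    · exact le_rfl
  have hlap : ∀ v ∈ D, lap g v / comb.degree v = -1 := fun v hv => by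
    have h1 : lap g v = -lap F v := by
      rw [← lap_neg, lap, lap]
      refine Finset.sum_congr rfl fun w hw => ?_
      have hvB : v ∈ B := Finset.mem_union_left _ hv
      have hwB : w ∈ B := Finset.mem_union_right _ (Finset.mem_biUnion.2 ⟨v, hv, hw⟩)
      simp only [g, hvB, hwB, if_true, Pi.neg_apply]
      ring
    have h2 : lap F v = comb.degree v := by
      obtain ⟨x, y⟩ := v
      rw [← SimpleGraph.card_neighborFinset_eq_degree, Finset.card_eq_sum_ones, Nat.cast_sum,
        sum_neighborFinset (fun _ => ((1 : ℕ) : ℝ)), lap_eq]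
      simp only [F]
      push_cast
      split_ifs <;> ring
    have hd : (comb.degree v : ℝ) ≠ 0 := by exact_mod_cast (degree_pos v).ne'
    rw [h1, h2, neg_div, div_self hd]
  have hstep : ∀ t, ∑ w ∈ B, killed μ Y D (t + 1) w * g w + ∑ w ∈ D, killed μ Y D t w ≤
      ∑ w ∈ B, killed μ Y D t w * g w := fun t => by
    rw [hY.sum_killed_succ D B g (fun w hw => by simp [g, hw]), ← Finset.sum_add_distrib]
    calc _ = ∑ w ∈ D, killed μ Y D t w * g w :=
          Finset.sum_congr rfl fun v hv => by rw [hlap v hv]; ring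
      _ ≤ _ := Finset.sum_le_sum_of_subset_of_nonneg Finset.subset_union_left
          fun w _ _ => mul_nonneg (killed_nonneg D t w) (hg0 w)
  have hsum : ∀ n, ∑ t ∈ Finset.range n, ∑ w ∈ D, killed μ Y D t w +
      ∑ w ∈ B, killed μ Y D n w * g w ≤ ∑ w ∈ B, killed μ Y D 0 w * g w := fun n => by
    induction n with
    | zero => simp
    | succ n ih =>
      rw [Finset.sum_range_succ]
      linarith [hstep n]
  refine (summable_of_sum_range_le (c := ∑ w ∈ B, killed μ Y D 0 w * g w)
    (fun t => Finset.sum_nonneg fun w _ => killed_nonneg D t w) fun n => ?_).tendsto_atTop_zero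
  have := Finset.sum_nonneg fun w (_ : w ∈ B) =>
    mul_nonneg (killed_nonneg (μ := μ) (Y := Y) D n w) (hg0 w)
  linarith [hsum n]

theorem sum_killed_le_exit (hY : IsSimpleRandomWalk μ Y) (D : Finset (ℤ × ℤ)) {w : ℤ × ℤ}
    (hw : w ∉ D) (n : ℕ) :
    ∑ t ∈ Finset.range n, killed μ Y D t w ≤
      μ.real {ω | w ∈ exitPoint D (fun t => Y t ω)} := by
  have hdisj : ∀ s t : ℕ, s < t → Disjoint {ω | (∀ r < s, Y r ω ∈ D) ∧ Y s ω = w}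
      {ω | (∀ r < t, Y r ω ∈ D) ∧ Y t ω = w} := fun s t hst =>
    Set.disjoint_left.2 fun ω h h' => hw (h.2 ▸ h'.1 s hst)
  have e : ∑ t ∈ Finset.range n, killed μ Y D t w =
      μ.real (⋃ t ∈ Finset.range n, {ω | (∀ s < t, Y s ω ∈ D) ∧ Y t ω = w}) := by
    rw [measureReal_biUnion_finset]
    · rfl
    · intro s _ t _ hst
      rcases hst.lt_or_gt with h | h
      · exact hdisj s t h
      · exact (hdisj t s h).symm
    · intro t _
      exact (hY.measurableSet_stay (D : Set (ℤ × ℤ)) t).inter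
        (hY.measurable t (measurableSet_singleton w))
  rw [e]
  refine measureReal_mono fun ω hω => ?_
  simp only [Set.mem_iUnion] at hω
  obtain ⟨t, _, h1, h2⟩ := hω
  exact ⟨t, h2, by simpa using hw, h1⟩

/-- Optional stopping: a bounded function which is subharmonic in `D` and vanishes outside `B`
increases in mean up to the exit from `D`. -/
theorem le_sum_exit (hY : IsSimpleRandomWalk μ Y) {D B : Finset (ℤ × ℤ)} (hDB : D ⊆ B)
    {H : ℤ × ℤ → ℝ} (hHB : ∀ w ∉ B, H w = 0) (h0 : ∀ w, 0 ≤ H w) (h1 : ∀ w, H w ≤ 1)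
    (hD : ∀ v ∈ D, 0 ≤ lap H v) :
    H (0, 0) ≤ ∑ w ∈ B \ D, H w * μ.real {ω | w ∈ exitPoint D (fun t => Y t ω)} := by
  have hsplit : ∀ f : ℤ × ℤ → ℝ, ∑ w ∈ B, f w = ∑ w ∈ B \ D, f w + ∑ w ∈ D, f w :=
    fun f => (Finset.sum_sdiff hDB).symm
  have hstep : ∀ t, ∑ w ∈ D, killed μ Y D t w * H w ≤ ∑ w ∈ B, killed μ Y D (t + 1) w * H w :=
    fun t => by
      rw [hY.sum_killed_succ D B H hHB]
      refine Finset.sum_le_sum fun v hv => mul_le_mul_of_nonneg_left ?_ (killed_nonneg D t v)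
      have := div_nonneg (hD v hv) (Nat.cast_nonneg (comb.degree v))
      linarith
  have hzero : ∑ w ∈ B, killed μ Y D 0 w * H w = H (0, 0) := by
    simp only [hY.killed_zero, ite_mul, one_mul, zero_mul, Finset.sum_ite_eq']
    split_ifs with h
    · rfl
    · exact (hHB _ h).symm
  have hmain : ∀ n, H (0, 0) ≤
      ∑ w ∈ B \ D, H w * ∑ t ∈ Finset.range (n + 1), killed μ Y D t w +
        ∑ w ∈ D, killed μ Y D n w * H w := fun n => by
    induction n with
    | zero =>
      rw [← hzero, hsplit]
      simp [mul_comm]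
    | succ n ih =>
      refine ih.trans ?_
      have h2 := hstep n
      rw [hsplit] at h2
      simp only [Finset.sum_range_succ _ (n + 1), mul_add, Finset.sum_add_distrib]
      have h3 : ∑ w ∈ B \ D, H w * killed μ Y D (n + 1) w =
        ∑ w ∈ B \ D, killed μ Y D (n + 1) w * H w := Finset.sum_congr rfl fun _ _ => mul_comm _ _
      linarith
  set S := ∑ w ∈ B \ D, H w * μ.real {ω | w ∈ exitPoint D (fun t => Y t ω)} with hS
  -- As H ≤ 1, the term not yet stopped is at most the mass remaining in D, which tends to 0.
  have hbound : ∀ n, H (0, 0) ≤ S + ∑ w ∈ D, killed μ Y D n w := fun n => by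
    refine (hmain n).trans (add_le_add ?_ ?_)
    · exact Finset.sum_le_sum fun w hw => mul_le_mul_of_nonneg_left
        (hY.sum_killed_le_exit D (Finset.mem_sdiff.1 hw).2 _) (h0 w)
    · exact Finset.sum_le_sum fun w _ => mul_le_of_le_one_right (killed_nonneg D n w) (h1 w)
  have := ge_of_tendsto' ((hY.tendsto_sum_killed D).const_add S) hbound
  simpa using this

end IsSimpleRandomWalk

/-! ### Exit values and their exponential moments. -/

theorem subsingleton_exitPoint (A : Set (ℤ × ℤ)) (y : ℕ → ℤ × ℤ) :
    (exitPoint A y).Subsingleton := by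
  rintro _ ⟨s, rfl, hs, hs'⟩ _ ⟨t, rfl, ht, ht'⟩
  rcases lt_trichotomy s t with h | rfl | h
  · exact absurd (ht' s h) hs
  · rfl
  · exact absurd (hs' t h) ht

open Classical in
/-- The value of `H`, restricted to `B`, at the point where the trajectory `y` leaves `D`. -/
noncomputable def exitValue (B : Finset (ℤ × ℤ)) (H : ℤ × ℤ → ℝ) (D : Set (ℤ × ℤ))
    (y : ℕ → ℤ × ℤ) : ℝ :=
  ∑ w ∈ B, if w ∈ exitPoint D y then H w else 0

theorem exitValue_nonneg {B : Finset (ℤ × ℤ)} {H : ℤ × ℤ → ℝ} (h0 : ∀ w, 0 ≤ H w)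
    (D : Set (ℤ × ℤ)) (y : ℕ → ℤ × ℤ) : 0 ≤ exitValue B H D y :=
  Finset.sum_nonneg fun w _ => by split_ifs <;> simp [h0]

theorem exitValue_le_one {B : Finset (ℤ × ℤ)} {H : ℤ × ℤ → ℝ} (h1 : ∀ w, H w ≤ 1)
    (D : Set (ℤ × ℤ)) (y : ℕ → ℤ × ℤ) : exitValue B H D y ≤ 1 := by
  classical
  by_cases h : ∃ w ∈ B, w ∈ exitPoint D y
  · obtain ⟨w, hw, hwe⟩ := h
    rw [exitValue, Finset.sum_eq_single_of_mem w hw, if_pos hwe]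
    · exact h1 w
    · intro v _ hv
      exact if_neg fun hve => hv (subsingleton_exitPoint D y hve hwe)
  · push Not at h
    rw [exitValue, Finset.sum_eq_zero fun w hw => if_neg (h w hw)]
    exact zero_le_one

theorem measurable_exitValue {Ω : Type*} {m : MeasurableSpace Ω} {Y : ℕ → Ω → ℤ × ℤ}
    (hY : ∀ t, Measurable (Y t)) {A : Ω → Set (ℤ × ℤ)} (hA : ∀ v, MeasurableSet {ω | v ∈ A ω})
    (B : Finset (ℤ × ℤ)) (H : ℤ × ℤ → ℝ) :
    Measurable fun ω => exitValue B H (A ω) (fun t => Y t ω) :=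
  Finset.measurable_fun_sum _ fun w _ =>
    Measurable.ite (measurableSet_exitPoint hY hA w) measurable_const measurable_const

/-- The exponential moment of the exit value of a single walk. -/
theorem IsSimpleRandomWalk.lintegral_exp_exitValue_le {Ω : Type*} [MeasurableSpace Ω]
    {μ : Measure Ω} [IsProbabilityMeasure μ] {Y : ℕ → Ω → ℤ × ℤ} (hY : IsSimpleRandomWalk μ Y)
    {D B : Finset (ℤ × ℤ)} (hDB : D ⊆ B) {H : ℤ × ℤ → ℝ} (hHB : ∀ w ∉ B, H w = 0)
    (h0 : ∀ w, 0 ≤ H w) (h1 : ∀ w, H w ≤ 1) (hD : ∀ v ∈ D, 0 ≤ lap H v) {s : ℝ} (hs : 0 ≤ s) :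
    ∫⁻ ω, ENNReal.ofReal (Real.exp (-(s * exitValue B H D fun t => Y t ω))) ∂μ ≤
      ENNReal.ofReal (Real.exp (-((1 - Real.exp (-s)) * H (0, 0)))) := by
  set V : Ω → ℝ := fun ω => exitValue B H D fun t => Y t ω with hV
  have hVm : Measurable V := measurable_exitValue hY.measurable (fun _ => MeasurableSet.const _) B H
  have hVint : Integrable V μ := Integrable.of_bound hVm.aestronglyMeasurable 1
    (ae_of_all _ fun ω => by
      rw [Real.norm_of_nonneg (exitValue_nonneg h0 _ _)]
      exact exitValue_le_one h1 _ _)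
  have hEV : H (0, 0) ≤ ∫ ω, V ω ∂μ := by
    refine (hY.le_sum_exit hDB hHB h0 h1 hD).trans ?_
    have hme : ∀ w, MeasurableSet {ω | w ∈ exitPoint D (fun t => Y t ω)} := fun w =>
      measurableSet_exitPoint hY.measurable (fun _ => MeasurableSet.const _) w
    have e : ∀ ω, V ω = ∑ w ∈ B,
        {ω | w ∈ exitPoint D (fun t => Y t ω)}.indicator (fun _ => H w) ω := fun ω => by
      classical
      refine Finset.sum_congr rfl fun w _ => ?_
      rw [Set.indicator_apply]
      rfl
    simp only [e]
    rw [integral_finsetSum _ fun w _ => (integrable_const (H w)).indicator (hme w)]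
    simp only [integral_indicator_const _ (hme _), smul_eq_mul]
    simp only [mul_comm]
    exact Finset.sum_le_sum_of_subset_of_nonneg Finset.sdiff_subset
      fun w _ _ => mul_nonneg (h0 w) measureReal_nonneg
  -- The chord bound for the convex exponential on [0, 1] makes the moment depend only on the mean
  -- of V.
  have hpt : ∀ ω, Real.exp (-(s * V ω)) ≤ 1 - (1 - Real.exp (-s)) * V ω := fun ω => by
    have ha : 0 ≤ V ω := exitValue_nonneg h0 _ _
    have hb : V ω ≤ 1 := exitValue_le_one h1 _ _
    have := convexOn_exp.2 (Set.mem_univ (-s)) (Set.mem_univ 0) ha (sub_nonneg.2 hb) (by ring)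
    simp only [smul_eq_mul, Real.exp_zero] at this
    rw [show V ω * -s + (1 - V ω) * 0 = -(s * V ω) by ring] at this
    linarith
  have hc : 0 ≤ 1 - Real.exp (-s) := by
    have := Real.exp_le_one_iff.2 (neg_nonpos.2 hs)
    linarith
  have hint : Integrable (fun ω => 1 - (1 - Real.exp (-s)) * V ω) μ :=
    (integrable_const 1).sub (hVint.const_mul _)
  calc _ ≤ ∫⁻ ω, ENNReal.ofReal (1 - (1 - Real.exp (-s)) * V ω) ∂μ :=
        lintegral_mono fun ω => ENNReal.ofReal_le_ofReal (hpt ω)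
    _ = ENNReal.ofReal (∫ ω, (1 - (1 - Real.exp (-s)) * V ω) ∂μ) :=
        (ofReal_integral_eq_lintegral_ofReal hint
          (ae_of_all _ fun ω => (Real.exp_pos _).le.trans (hpt ω))).symm
    _ ≤ _ := by
      refine ENNReal.ofReal_le_ofReal ?_
      rw [integral_sub (integrable_const 1) (hVint.const_mul _), integral_const_mul]
      simp only [integral_const, probReal_univ, smul_eq_mul, one_mul]
      have h2 := mul_le_mul_of_nonneg_left hEV hc
      have h3 := Real.add_one_le_exp (-((1 - Real.exp (-s)) * H (0, 0)))
      linarith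

/-! ### Exit values counted by settled sites. -/

theorem cluster_mono (x : ℕ → ℕ → ℤ × ℤ) (n : ℕ) : cluster x n ⊆ cluster x (n + 1) :=
  Set.subset_union_left

open Classical in
/-- The part of the cluster inside `B`, with the point `z` removed. -/
noncomputable def clusterIn (B : Finset (ℤ × ℤ)) (z : ℤ × ℤ) (x : ℕ → ℕ → ℤ × ℤ) (n : ℕ) :
    Finset (ℤ × ℤ) :=
  (B.erase z).filter (· ∈ cluster x n)

-- Since z is unoccupied, a walk leaving `clusterIn` at a site of B leaves the whole cluster there
-- and settles at that site. Thus each exit value is charged to a different site of the cluster;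
-- exits outside B count zero.
open Classical in
theorem sum_exitValue_le {B : Finset (ℤ × ℤ)} {z : ℤ × ℤ} {H : ℤ × ℤ → ℝ} (h0 : ∀ w, 0 ≤ H w)
    (x : ℕ → ℕ → ℤ × ℤ) (n : ℕ) (hz : z ∉ cluster x n) :
    ∑ j ∈ Finset.range n, exitValue B H (clusterIn B z x j) (x j) ≤
      ∑ w ∈ B, if w ∈ cluster x n then H w else 0 := by
  induction n with
  | zero => simp [cluster]
  | succ n ih =>
    have hzn : z ∉ cluster x n := fun h => hz (cluster_mono x n h)
    rw [Finset.sum_range_succ]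
    refine (add_le_add_left (ih hzn) _).trans ?_
    rw [exitValue, ← Finset.sum_add_distrib]
    refine Finset.sum_le_sum fun w hw => ?_
    by_cases he : w ∈ exitPoint (clusterIn B z x n) (x n)
    · obtain ⟨t, ht, hw1, hs⟩ := he
      have hsub : ∀ v ∈ clusterIn B z x n, v ∈ cluster x n := fun v hv =>
        (Finset.mem_filter.1 hv).2
      have hstay : ∀ s < t, x n s ∈ cluster x n := fun s hst => hsub _ (hs s hst)
      have hwn : w ∉ cluster x n := fun hwc => by
        refine hw1 (Finset.mem_coe.2 (Finset.mem_filter.2 ⟨Finset.mem_erase.2 ⟨?_, hw⟩, hwc⟩))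
        rintro rfl
        exact hzn hwc
      have hw' : w ∈ cluster x (n + 1) := Or.inr ⟨t, ht, hwn, hstay⟩
      rw [if_neg hwn, if_pos hw', zero_add]
      split_ifs
      · exact le_rfl
      · exact h0 w
    · rw [if_neg he, add_zero]
      by_cases hwn : w ∈ cluster x n
      · rw [if_pos hwn, if_pos (cluster_mono x n hwn)]
      · rw [if_neg hwn]
        split_ifs
        · exact h0 w
        · exact le_rfl

/-! ### Independence of successive walks and the Chernoff bound. -/

section Filtration

variable {Ω : Type*}

/-- The σ-algebra generated by the first `n` walks. -/
@[reducible]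
def past (X : ℕ → ℕ → Ω → ℤ × ℤ) (n : ℕ) : MeasurableSpace Ω :=
  ⨆ i ∈ Set.Iio n, MeasurableSpace.comap (fun ω t => X i t ω) inferInstance

theorem past_mono (X : ℕ → ℕ → Ω → ℤ × ℤ) {m n : ℕ} (h : m ≤ n) : past X m ≤ past X n :=
  biSup_mono fun _ hi => lt_of_lt_of_le hi h

theorem measurable_past (X : ℕ → ℕ → Ω → ℤ × ℤ) {i n : ℕ} (h : i < n) (t : ℕ) :
    Measurable[past X n] (X i t) := by
  have h1 : Measurable[past X n] (fun ω t => X i t ω) :=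
    Measurable.mono (comap_measurable _)
      (le_biSup (fun i => MeasurableSpace.comap (fun ω t => X i t ω) inferInstance)
        (show i ∈ Set.Iio n from h)) le_rfl
  exact (measurable_pi_apply t).comp h1

theorem measurableSet_mem_cluster (X : ℕ → ℕ → Ω → ℤ × ℤ) (n : ℕ) (v : ℤ × ℤ) :
    MeasurableSet[past X n] {ω | v ∈ cluster (fun i t => X i t ω) n} := by
  induction n generalizing v with
  | zero => simp [cluster]
  | succ n ih =>
    have ih' : ∀ v, MeasurableSet[past X (n + 1)] {ω | v ∈ cluster (fun i t => X i t ω) n} :=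
      fun v => past_mono X n.le_succ _ (ih v)
    have h := @measurableSet_exitPoint Ω (past X (n + 1)) (X n)
      (measurable_past X n.lt_succ_self) (fun ω => cluster (fun i t => X i t ω) n) ih' v
    exact (ih' v).union h

theorem measurableSet_mem_clusterIn (B : Finset (ℤ × ℤ)) (z : ℤ × ℤ) (X : ℕ → ℕ → Ω → ℤ × ℤ)
    (n : ℕ) (v : ℤ × ℤ) :
    MeasurableSet[past X n] {ω | v ∈ clusterIn B z (fun i t => X i t ω) n} := by
  classical
  simp only [clusterIn, Finset.mem_filter]
  exact (MeasurableSet.const _).inter (measurableSet_mem_cluster X n v)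

theorem measurableSet_clusterIn_eq (B : Finset (ℤ × ℤ)) (z : ℤ × ℤ) (X : ℕ → ℕ → Ω → ℤ × ℤ)
    (n : ℕ) (S : Finset (ℤ × ℤ)) :
    MeasurableSet[past X n] {ω | clusterIn B z (fun i t => X i t ω) n = S} := by
  have : {ω | clusterIn B z (fun i t => X i t ω) n = S} =
      ⋂ v : ℤ × ℤ, {ω | v ∈ clusterIn B z (fun i t => X i t ω) n ↔ v ∈ S} := by
    ext ω
    simp [Finset.ext_iff]
  rw [this]
  exact @MeasurableSet.iInter _ _ (past X n) _ _ fun v =>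
    (measurableSet_mem_clusterIn B z X n v).iff (MeasurableSet.const _)

theorem measurable_sum_exitValue (B : Finset (ℤ × ℤ)) (z : ℤ × ℤ) (H : ℤ × ℤ → ℝ)
    (X : ℕ → ℕ → Ω → ℤ × ℤ) (n : ℕ) :
    Measurable[past X n] fun ω => ∑ j ∈ Finset.range n,
      exitValue B H (clusterIn B z (fun i t => X i t ω) j) (fun t => X j t ω) := by
  refine Finset.measurable_fun_sum _ fun j hj => ?_
  have hj' : j < n := Finset.mem_range.1 hj
  exact @measurable_exitValue Ω (past X n) (X j) (measurable_past X hj')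
    (fun ω => clusterIn B z (fun i t => X i t ω) j)
    (fun v => past_mono X hj'.le _ (measurableSet_mem_clusterIn B z X j v)) B H

variable [MeasurableSpace Ω] {μ : Measure Ω} [IsProbabilityMeasure μ] {X : ℕ → ℕ → Ω → ℤ × ℤ}

/-- The exponential moment of the sum of the exit values of the first `n` walks. -/
theorem lintegral_exp_sum_exitValue_le (hX : ∀ i, IsSimpleRandomWalk μ (X i))
    (hindep : iIndepFun (fun i ω t => X i t ω) μ) {B : Finset (ℤ × ℤ)} {z : ℤ × ℤ}
    {H : ℤ × ℤ → ℝ} (hH : IsHittingFunction B z H) {s : ℝ} (hs : 0 ≤ s) (n : ℕ) :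
    ∫⁻ ω, ENNReal.ofReal (Real.exp (-(s * ∑ j ∈ Finset.range n,
      exitValue B H (clusterIn B z (fun i t => X i t ω) j) (fun t => X j t ω)))) ∂μ ≤
      ENNReal.ofReal (Real.exp (-((1 - Real.exp (-s)) * H (0, 0)))) ^ n := by
  classical
  have hXm : ∀ i, Measurable fun ω t => X i t ω := fun i =>
    measurable_pi_lambda _ fun t => (hX i).measurable t
  have hle : ∀ i, MeasurableSpace.comap (fun ω t => X i t ω) inferInstance ≤
    (inferInstance : MeasurableSpace Ω) := fun i => (hXm i).comap_le
  have hpast : ∀ n, past X n ≤ (inferInstance : MeasurableSpace Ω) := fun n =>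
    iSup₂_le fun i _ => hle i
  induction n with
  | zero => simp
  | succ n ih =>
    set c := ENNReal.ofReal (Real.exp (-((1 - Real.exp (-s)) * H (0, 0)))) with hc
    let W : Ω → ENNReal := fun ω => ENNReal.ofReal (Real.exp (-(s * ∑ j ∈ Finset.range n,
      exitValue B H (clusterIn B z (fun i t => X i t ω) j) (fun t => X j t ω))))
    let E : Finset (ℤ × ℤ) → Set Ω := fun S => {ω | clusterIn B z (fun i t => X i t ω) n = S}
    let g : Finset (ℤ × ℤ) → Ω → ENNReal := fun S ω =>
      ENNReal.ofReal (Real.exp (-(s * exitValue B H S fun t => X n t ω)))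
    have hW : Measurable[past X n] W := by
      have := measurable_sum_exitValue B z H X n
      exact ENNReal.measurable_ofReal.comp (Real.measurable_exp.comp (this.const_mul s).neg)
    have hE : ∀ S, MeasurableSet[past X n] (E S) := measurableSet_clusterIn_eq B z X n
    have hWE : ∀ S, Measurable[past X n] ((E S).indicator W) := fun S => hW.indicator (hE S)
    have hg : ∀ S, Measurable[MeasurableSpace.comap (fun ω t => X n t ω) inferInstance] (g S) :=
      fun S => by
        have hm : ∀ t, Measurable[MeasurableSpace.comap (fun ω t => X n t ω) inferInstance] (X n t) :=
          fun t => (measurable_pi_apply t).comp (comap_measurable (fun ω t => X n t ω))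
        have := @measurable_exitValue Ω (MeasurableSpace.comap (fun ω t => X n t ω) inferInstance)
          (X n) hm (fun _ => S) (fun _ => MeasurableSet.const _) B H
        exact ENNReal.measurable_ofReal.comp (Real.measurable_exp.comp (this.const_mul s).neg)
    have hind : Indep (past X n) (MeasurableSpace.comap (fun ω t => X n t ω) inferInstance) μ := by
      have := indep_iSup_of_disjoint hle hindep.iIndep
        (S := Set.Iio n) (T := {n}) (by simp)
      simpa [past] using this
    -- Splitting over the finitely many values S of the random set makes the last walk exit a
    -- deterministic set, so each summand is a product of independent factors.
    have hdecomp : ∀ ω, ENNReal.ofReal (Real.exp (-(s * ∑ j ∈ Finset.range (n + 1),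
        exitValue B H (clusterIn B z (fun i t => X i t ω) j) (fun t => X j t ω)))) =
        ∑ S ∈ (B.erase z).powerset, (E S).indicator W ω * g S ω := fun ω => by
      rw [Finset.sum_eq_single_of_mem (clusterIn B z (fun i t => X i t ω) n)
        (Finset.mem_powerset.2 (Finset.filter_subset _ _))]
      · rw [Set.indicator_of_mem (show ω ∈ E _ from rfl), ← ENNReal.ofReal_mul (Real.exp_pos _).le,
          ← Real.exp_add, Finset.sum_range_succ]
        congr 2
        ring
      · intro S _ hS
        rw [Set.indicator_of_notMem (fun h : ω ∈ E S => hS (Eq.symm h)), zero_mul]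
    have hWsum : ∀ ω, ∑ S ∈ (B.erase z).powerset, (E S).indicator W ω = W ω := fun ω => by
      rw [Finset.sum_eq_single_of_mem (clusterIn B z (fun i t => X i t ω) n)
        (Finset.mem_powerset.2 (Finset.filter_subset _ _))]
      · exact Set.indicator_of_mem (show ω ∈ E _ from rfl) _
      · intro S _ hS
        exact Set.indicator_of_notMem (fun h : ω ∈ E S => hS (Eq.symm h)) _
    have hgle : ∀ S ∈ (B.erase z).powerset, ∫⁻ ω, g S ω ∂μ ≤ c := fun S hS => by
      have hSB := Finset.mem_powerset.1 hS
      exact (hX n).lintegral_exp_exitValue_le (hSB.trans (Finset.erase_subset _ _))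
        hH.apply_of_notMem hH.nonneg hH.le_one (fun v hv =>
          (hH.lap_eq_zero v (Finset.mem_of_mem_erase (hSB hv)) (Finset.ne_of_mem_erase (hSB hv))).ge)
        hs
    simp only [hdecomp]
    have hWgm : ∀ S, Measurable fun ω => (E S).indicator W ω * g S ω := fun S =>
      ((hWE S).mono (hpast n) le_rfl).mul ((hg S).mono (hle n) le_rfl)
    rw [lintegral_finsetSum _ fun S _ => hWgm S]
    calc _ = ∑ S ∈ (B.erase z).powerset, (∫⁻ ω, (E S).indicator W ω ∂μ) * ∫⁻ ω, g S ω ∂μ :=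
          Finset.sum_congr rfl fun S _ =>
            lintegral_mul_eq_lintegral_mul_lintegral_of_independent_measurableSpace
              (hpast n) (hle n) hind (hWE S) (hg S)
      _ ≤ ∑ S ∈ (B.erase z).powerset, (∫⁻ ω, (E S).indicator W ω ∂μ) * c :=
          Finset.sum_le_sum fun S hS => mul_le_mul_right (hgle S hS) _
      _ = (∫⁻ ω, W ω ∂μ) * c := by
          rw [← Finset.sum_mul, ← lintegral_finsetSum _ fun S _ => (hWE S).mono (hpast n) le_rfl]
          simp only [hWsum]
      _ ≤ c ^ n * c := mul_le_mul_left ih _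
      _ = c ^ (n + 1) := (pow_succ c n).symm

/-- A point which is hit by many more walks than can settle before hitting it is likely to belong
to the cluster. -/
theorem measure_notMem_cluster_le (hX : ∀ i, IsSimpleRandomWalk μ (X i))
    (hindep : iIndepFun (fun i ω t => X i t ω) μ) {B : Finset (ℤ × ℤ)} {z : ℤ × ℤ}
    {H : ℤ × ℤ → ℝ} (hH : IsHittingFunction B z H) {n : ℕ} (hn : 0 < n) {r : ℝ} (hr : 0 ≤ r)
    (hsum : ∑ w ∈ B, H w ≤ n * H (0, 0) - r) :
    μ {ω | z ∉ cluster (fun i t => X i t ω) n} ≤ ENNReal.ofReal (Real.exp (-(r ^ 2 / (4 * n)))) := by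
  classical
  have hn' : (0 : ℝ) < n := by exact_mod_cast hn
  set a := ∑ w ∈ B, H w with ha
  have ha0 : 0 ≤ a := Finset.sum_nonneg fun w _ => hH.nonneg w
  have hHo := hH.le_one (0, 0)
  have hrn : r ≤ n := by nlinarith
  -- This s minimises -s r + s² n, the exponent left after 1 - exp(-s) ≥ s - s², which needs s ≤ 1.
  set s := r / (2 * n) with hs
  have hs0 : 0 ≤ s := by positivity
  have hs1 : s ≤ 1 := by rw [hs, div_le_one (by positivity)]; linarith
  let V : Ω → ℝ := fun ω => ∑ j ∈ Finset.range n,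
    exitValue B H (clusterIn B z (fun i t => X i t ω) j) (fun t => X j t ω)
  have hpast : past X n ≤ (inferInstance : MeasurableSpace Ω) := iSup₂_le fun i _ =>
    (measurable_pi_lambda _ fun t => (hX i).measurable t : Measurable fun ω t => X i t ω).comap_le
  have hV : Measurable V := (measurable_sum_exitValue B z H X n).mono hpast le_rfl
  have hsub : {ω | z ∉ cluster (fun i t => X i t ω) n} ⊆
      {ω | ENNReal.ofReal (Real.exp (-(s * a))) ≤ ENNReal.ofReal (Real.exp (-(s * V ω)))} := by
    intro ω hω
    refine ENNReal.ofReal_le_ofReal (Real.exp_le_exp.2 (neg_le_neg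
      (mul_le_mul_of_nonneg_left ?_ hs0)))
    refine (sum_exitValue_le hH.nonneg (fun i t => X i t ω) n hω).trans
      (Finset.sum_le_sum fun w _ => ?_)
    split_ifs
    · exact le_rfl
    · exact hH.nonneg w
  have hm := mul_meas_ge_le_lintegral (μ := μ) (f := fun ω => ENNReal.ofReal
    (Real.exp (-(s * V ω)))) (by fun_prop) (ENNReal.ofReal (Real.exp (-(s * a))))
  have h1 := hm.trans (lintegral_exp_sum_exitValue_le hX hindep hH hs0 n)
  have h2 : μ {ω | ENNReal.ofReal (Real.exp (-(s * a))) ≤ ENNReal.ofReal (Real.exp (-(s * V ω)))} ≤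
      ENNReal.ofReal (Real.exp (s * a)) *
        ENNReal.ofReal (Real.exp (-((1 - Real.exp (-s)) * H (0, 0)))) ^ n := by
    refine le_trans (le_of_eq ?_) (mul_le_mul_right h1 _)
    rw [← mul_assoc, ← ENNReal.ofReal_mul (Real.exp_pos _).le, ← Real.exp_add, add_neg_cancel,
      Real.exp_zero, ENNReal.ofReal_one, one_mul]
  refine (measure_mono hsub).trans (h2.trans ?_)
  rw [← ENNReal.ofReal_pow (Real.exp_pos _).le, ← Real.exp_nat_mul,
    ← ENNReal.ofReal_mul (Real.exp_pos _).le, ← Real.exp_add]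
  refine ENNReal.ofReal_le_ofReal (Real.exp_le_exp.2 ?_)
  have h3 := abs_le.1 (Real.abs_exp_sub_one_sub_id_le (x := -s) (by rw [abs_neg, abs_of_nonneg hs0]; exact hs1))
  have h4 : s - s ^ 2 ≤ 1 - Real.exp (-s) := by nlinarith [h3.2]
  have h5 : s * a ≤ s * (n * H (0, 0) - r) := mul_le_mul_of_nonneg_left hsum hs0
  have h6 : (s - s ^ 2) * (n * H (0, 0)) ≤ (1 - Real.exp (-s)) * (n * H (0, 0)) :=
    mul_le_mul_of_nonneg_right h4 (mul_nonneg hn'.le (hH.nonneg _))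
  have h7 : s ^ 2 * (n * H (0, 0)) ≤ s ^ 2 * n :=
    mul_le_mul_of_nonneg_left (mul_le_of_le_one_right hn'.le hHo) (sq_nonneg s)
  have h8 : -(s * r) + s ^ 2 * n = -(r ^ 2 / (4 * n)) := by
    rw [hs]; field_simp; ring
  nlinarith

end Filtration

/-! ### The approximate sandpile odometer. -/

/-- A function with second difference `1` on the positive half line. -/
noncomputable def tri (t : ℝ) : ℝ := if 0 < t then t * (t + 1) / 2 else 0

theorem tri_of_nonneg {t : ℝ} (ht : 0 ≤ t) : tri t = t * (t + 1) / 2 := by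
  unfold tri
  split_ifs with h
  · rfl
  · rw [le_antisymm (not_lt.1 h) ht]; ring

/-- The parabola is nonpositive on [-1, 0], so truncating it there only raises it. This covers the
last site of a tooth, whose outer neighbour has gap in (-1, 0]. -/
theorem le_tri {t : ℝ} (ht : -1 ≤ t) : t * (t + 1) / 2 ≤ tri t := by
  unfold tri
  split_ifs with h
  · exact le_rfl
  · nlinarith

theorem tri_nonneg (t : ℝ) : 0 ≤ tri t := by
  unfold tri
  split_ifs with h
  · positivity
  · exact le_rfl

theorem tri_eq_zero {t : ℝ} (ht : t ≤ 0) : tri t = 0 := if_neg (not_lt.2 ht)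

/-- The half-length of the tooth at `x` of a cluster of width `M`. -/
noncomputable def toothLength (M : ℕ) (x : ℤ) : ℝ :=
  max ((M : ℝ) - |(x : ℝ)|) 0 * (max ((M : ℝ) - |(x : ℝ)|) 0 + 3) / 3

/-- The distance to the end of the tooth. -/
noncomputable def gap (M : ℕ) (v : ℤ × ℤ) : ℝ := toothLength M v.1 - |(v.2 : ℝ)|

/-- A lower approximation of the odometer function of the divisible sandpile. -/
noncomputable def odometer (M : ℕ) (v : ℤ × ℤ) : ℝ := tri (gap M v)

theorem toothLength_of_le {M : ℕ} {x : ℤ} (h : |(x : ℝ)| ≤ M) :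
    toothLength M x = (M - |(x : ℝ)|) * (M - |(x : ℝ)| + 3) / 3 := by
  rw [toothLength, max_eq_left (by linarith)]

theorem toothLength_nonneg (M : ℕ) (x : ℤ) : 0 ≤ toothLength M x := by
  unfold toothLength
  positivity

theorem toothLength_le (M : ℕ) (x : ℤ) : toothLength M x ≤ (M : ℝ) ^ 2 + M := by
  have h0 : 0 ≤ max ((M : ℝ) - |(x : ℝ)|) 0 := le_max_right _ _
  have h1 : max ((M : ℝ) - |(x : ℝ)|) 0 ≤ M :=
    max_le (by linarith [abs_nonneg (x : ℝ)]) (Nat.cast_nonneg M)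
  unfold toothLength
  nlinarith

theorem abs_lt_of_gap_pos {M : ℕ} {v : ℤ × ℤ} (h : 0 < gap M v) : |(v.1 : ℝ)| < M := by
  by_contra! hle
  have h1 : max ((M : ℝ) - |(v.1 : ℝ)|) 0 = 0 := max_eq_right (by linarith)
  have h2 := abs_nonneg (v.2 : ℝ)
  rw [gap, toothLength, h1] at h
  linarith

/-- The support of the odometer function. -/
noncomputable def region (M : ℕ) : Finset (ℤ × ℤ) :=
  (Finset.Icc (-(M : ℤ)) M ×ˢ Finset.Icc (-((M : ℤ) ^ 2 + M)) ((M : ℤ) ^ 2 + M)).filter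
    fun v => 0 < gap M v

theorem abs_snd_lt_of_gap_pos {M : ℕ} {v : ℤ × ℤ} (h : 0 < gap M v) :
    |v.2| < ((M ^ 2 + M : ℕ) : ℤ) := by
  have h1 := toothLength_le M v.1
  have h2 : |(v.2 : ℝ)| < (M : ℝ) ^ 2 + M := by
    rw [gap] at h
    linarith
  exact_mod_cast h2

theorem mem_region {M : ℕ} {v : ℤ × ℤ} : v ∈ region M ↔ 0 < gap M v := by
  refine ⟨fun h => (Finset.mem_filter.1 h).2, fun h => Finset.mem_filter.2 ⟨?_, h⟩⟩
  have h1 : |v.1| < (M : ℤ) := by exact_mod_cast abs_lt_of_gap_pos h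
  have h2 := abs_lt.1 (abs_snd_lt_of_gap_pos h)
  have h3 := abs_lt.1 h1
  push_cast at h2
  simp only [Finset.mem_product, Finset.mem_Icc]
  exact ⟨⟨h3.1.le, h3.2.le⟩, h2.1.le, h2.2.le⟩

theorem card_region_le {M : ℕ} (hM : 1 ≤ M) : (region M).card ≤ 15 * M ^ 3 := by
  refine (Finset.card_filter_le _ _).trans ?_
  rw [Finset.card_product, Int.card_Icc, Int.card_Icc]
  have h1 : ((M : ℤ) + 1 - -(M : ℤ)).toNat = 2 * M + 1 := by omega
  have h2 : ((M : ℤ) ^ 2 + M + 1 - -((M : ℤ) ^ 2 + M)).toNat = 2 * (M ^ 2 + M) + 1 := by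
    rw [show (M : ℤ) ^ 2 + M + 1 - -((M : ℤ) ^ 2 + M) = ((2 * (M ^ 2 + M) + 1 : ℕ) : ℤ) by
      push_cast; ring, Int.toNat_natCast]
  rw [h1, h2]
  -- The constant is 3 · 5: 2M + 1 ≤ 3M and 2M² + 2M + 1 ≤ 5M².
  nlinarith [Nat.mul_le_mul hM hM, Nat.mul_le_mul (Nat.mul_le_mul hM hM) hM,
    Nat.mul_le_mul_left (M * M) hM, Nat.mul_le_mul_left M hM]

theorem odometer_eq_zero {M : ℕ} {v : ℤ × ℤ} (h : v ∉ region M) : odometer M v = 0 :=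
  tri_eq_zero (not_lt.1 fun h' => h (mem_region.2 h'))

theorem abs_succ_pred_cases {x : ℤ} (hx : x ≠ 0) :
    (|((x + 1 : ℤ) : ℝ)| = |(x : ℝ)| + 1 ∧ |((x - 1 : ℤ) : ℝ)| = |(x : ℝ)| - 1) ∨
    (|((x + 1 : ℤ) : ℝ)| = |(x : ℝ)| - 1 ∧ |((x - 1 : ℤ) : ℝ)| = |(x : ℝ)| + 1) := by
  rcases lt_or_gt_of_ne hx with h | h
  · right
    have h' : (x : ℝ) + 1 ≤ 0 := by exact_mod_cast h
    push_cast
    rw [abs_of_nonpos h', abs_of_nonpos (by linarith : (x : ℝ) ≤ 0),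
      abs_of_nonpos (by linarith : (x : ℝ) - 1 ≤ 0)]
    constructor <;> ring
  · left
    have h' : (1 : ℝ) ≤ x := by exact_mod_cast h
    push_cast
    rw [abs_of_nonneg (by linarith : 0 ≤ (x : ℝ) + 1), abs_of_nonneg (by linarith : 0 ≤ (x : ℝ)),
      abs_of_nonneg (by linarith : 0 ≤ (x : ℝ) - 1)]
    exact ⟨rfl, rfl⟩

theorem odometer_axis (M : ℕ) (x : ℤ) :
    odometer M (x, 0) = toothLength M x * (toothLength M x + 1) / 2 := by
  have : gap M (x, 0) = toothLength M x := by simp [gap]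
  rw [odometer, this, tri_of_nonneg (toothLength_nonneg M x)]

theorem vertical_axis (M : ℕ) (x : ℤ) :
    -(2 * toothLength M x) ≤
      odometer M (x, 0 + 1) + odometer M (x, 0 - 1) - 2 * odometer M (x, 0) := by
  have hL := toothLength_nonneg M x
  have h1 : gap M (x, 0 + 1) = toothLength M x - 1 := by simp [gap]
  have h2 : gap M (x, 0 - 1) = toothLength M x - 1 := by simp [gap]
  rw [odometer_axis, odometer, odometer, h1, h2]
  have := le_tri (t := toothLength M x - 1) (by linarith)
  nlinarith

/-- On the axis put h = M - |x| and L = h(h + 3)/3. The second difference of L(L + 1)/2 in h is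
2h²/3 + 2h + 13/9 = 2L + 13/9, while the vertical part is at least -2L. The 3 in L is what makes the
discrete terms linear in h cancel. -/
theorem one_le_lap_odometer {M : ℕ} {v : ℤ × ℤ} (hv : v ∈ region M) (h0 : v ≠ (0, 0)) :
    1 ≤ lap (odometer M) v := by
  obtain ⟨x, y⟩ := v
  have hg := mem_region.1 hv
  have hx : |(x : ℝ)| < M := abs_lt_of_gap_pos hg
  rw [lap_eq]
  by_cases hy : y = 0
  · subst hy
    have hx0 : x ≠ 0 := fun h => h0 (by rw [h])
    rw [if_pos rfl]
    have hver := vertical_axis M x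
    rw [odometer_axis M (x + 1), odometer_axis M (x - 1), odometer_axis M x] at *
    have hx' : |(x : ℝ)| + 1 ≤ M := by exact_mod_cast (by exact_mod_cast hx : |x| < (M : ℤ))
    rw [toothLength_of_le hx.le] at *
    rcases abs_succ_pred_cases hx0 with ⟨h1, h2⟩ | ⟨h1, h2⟩
    all_goals
      rw [toothLength_of_le (x := x + 1) (by linarith), toothLength_of_le (x := x - 1) (by linarith),
        h1, h2]
      obtain ⟨m, hm⟩ : ∃ m, |(x : ℝ)| = M - m := ⟨M - |(x : ℝ)|, by ring⟩
      rw [hm] at hver ⊢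
      nlinarith
  · rw [if_neg hy, add_zero]
    have key : ∀ t : ℝ, 0 < t → 1 ≤ tri (t + 1) + tri (t - 1) - 2 * tri t := fun t ht => by
      have h1 := le_tri (t := t - 1) (by linarith)
      rw [tri_of_nonneg (t := t + 1) (by linarith), tri_of_nonneg ht.le]
      nlinarith
    have := key _ hg
    simp only [odometer]
    rcases abs_succ_pred_cases hy with ⟨h1, h2⟩ | ⟨h1, h2⟩
    · have e1 : gap M (x, y + 1) = gap M (x, y) - 1 := by simp only [gap]; rw [h1]; ring
      have e2 : gap M (x, y - 1) = gap M (x, y) + 1 := by simp only [gap]; rw [h2]; ring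
      rw [e1, e2]; linarith
    · have e1 : gap M (x, y + 1) = gap M (x, y) + 1 := by simp only [gap]; rw [h1]; ring
      have e2 : gap M (x, y - 1) = gap M (x, y) - 1 := by simp only [gap]; rw [h2]; ring
      rw [e1, e2]; linarith

theorem lap_odometer_origin {M : ℕ} (hM : 1 ≤ M) :
    -(4 / 9 * (M : ℝ) ^ 3 + 6 * (M : ℝ) ^ 2) ≤ lap (odometer M) (0, 0) := by
  have hM' : (1 : ℝ) ≤ M := by exact_mod_cast hM
  have hver := vertical_axis M 0
  rw [lap_eq, if_pos rfl]
  rw [odometer_axis M (0 + 1), odometer_axis M (0 - 1), odometer_axis M 0] at *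
  rw [toothLength_of_le (x := 0) (by simp)] at *
  rw [toothLength_of_le (x := 0 + 1) (by simpa), toothLength_of_le (x := 0 - 1) (by simpa)]
  simp only [zero_add, zero_sub, Int.cast_neg, Int.cast_one, Int.cast_zero, abs_neg, abs_one,
    abs_zero, sub_zero] at *
  nlinarith

/-- The expected number of walks among the first `n` hitting `z` exceeds the expected number of
those starting from the points of `region M`. -/
theorem IsHittingFunction.sum_le {M : ℕ} (hM : 1 ≤ M) {n : ℕ}
    (hn : 4 / 9 * (M : ℝ) ^ 3 + 7 * (M : ℝ) ^ 2 ≤ n) {z : ℤ × ℤ} (hz : z ∈ region M)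
    {H : ℤ × ℤ → ℝ} (hH : IsHittingFunction (region M) z H) :
    ∑ w ∈ region M, H w ≤ n * H (0, 0) - odometer M z / (M ^ 2 + M : ℕ) := by
  have hM' : (1 : ℝ) ≤ M := by exact_mod_cast hM
  have ho : ((0, 0) : ℤ × ℤ) ∈ region M := by
    rw [mem_region, gap, toothLength_of_le (by simp)]
    simp only [Int.cast_zero, abs_zero, sub_zero]
    positivity
  have h1 := sum_mul_lap_comm (region M) H (odometer M) hH.apply_of_notMem
    fun v hv => odometer_eq_zero hv
  have h2 : ∑ v ∈ region M, odometer M v * lap H v ≤ -(odometer M z / (M ^ 2 + M : ℕ)) := by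
    rw [Finset.sum_eq_single_of_mem z hz fun v hv hvz => by rw [hH.lap_eq_zero v hv hvz, mul_zero]]
    obtain ⟨x, y⟩ := z
    have := hH.lap_self_le (d := M ^ 2 + M) (by positivity)
      fun v hv _ => abs_snd_lt_of_gap_pos (mem_region.1 hv)
    calc _ ≤ odometer M (x, y) * -(1 / ((M ^ 2 + M : ℕ) : ℝ)) :=
          mul_le_mul_of_nonneg_left this (tri_nonneg _)
      _ = _ := by ring
  have h3 : ∑ v ∈ region M, H v * (1 - if v = (0, 0) then (n : ℝ) else 0) ≤
      ∑ v ∈ region M, H v * lap (odometer M) v := by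
    refine Finset.sum_le_sum fun v hv => mul_le_mul_of_nonneg_left ?_ (hH.nonneg v)
    split_ifs with hv0
    · subst hv0
      -- The spare M² between 7M² and 6M² absorbs the 1 in 1 - n.
      nlinarith [lap_odometer_origin hM]
    · simpa using one_le_lap_odometer hv hv0
  have h4 : ∑ v ∈ region M, H v * (1 - if v = (0, 0) then (n : ℝ) else 0) =
      ∑ v ∈ region M, H v - n * H (0, 0) := by
    simp only [mul_sub, mul_one, Finset.sum_sub_distrib, mul_ite, mul_zero, Finset.sum_ite_eq',
      if_pos ho, mul_comm]
  linarith

/-! ### The limiting shape, the union bound and Borel–Cantelli. -/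

theorem k_pos : 0 < k := by unfold k; positivity

theorem l_pos : 0 < l := by unfold l; positivity

theorem k_pow_three : k ^ 3 = 9 / 4 := by
  rw [k, ← Real.rpow_natCast, ← Real.rpow_mul (by norm_num)]
  norm_num

/-- Turns k √(|y|/l) into √(3|y|), matching the tooth length (M - |x|)²/3 to leading order. -/
theorem k_sq : k ^ 2 = 3 * l := by
  have h : ((3 / 2 : ℝ) ^ (2 / 3 : ℝ)) ^ 2 = (3 / 2 : ℝ) ^ (1 / 3 : ℝ) * (3 / 2) := by
    rw [← Real.rpow_natCast, ← Real.rpow_mul (by norm_num)]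
    conv_rhs => rw [← Real.rpow_add_one (by norm_num)]
    norm_num
  rw [k, l, h]
  ring

theorem ball_mono {r s : ℝ} (h : r ≤ s) : ball r ⊆ ball s := fun _ hz =>
  ⟨hz.1.trans h, hz.2.trans (Real.rpow_le_rpow hz.1 h (by norm_num))⟩

theorem abs_add_sqrt_le_of_mem_ball {r : ℝ} {z : ℤ × ℤ} (hz : z ∈ ball r) :
    |(z.1 : ℝ)| + √(3 * |(z.2 : ℝ)|) ≤ k * r ^ (1 / 3 : ℝ) := by
  have h1 := mul_le_mul_of_nonneg_left hz.2 k_pos.le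
  have h2 : k * (|(z.2 : ℝ)| / l) ^ (1 / 2 : ℝ) = √(3 * |(z.2 : ℝ)|) := by
    rw [← Real.sqrt_eq_rpow]
    conv_lhs => rw [← Real.sqrt_sq k_pos.le]
    rw [← Real.sqrt_mul (sq_nonneg k), k_sq]
    congr 1
    field_simp [l_pos.ne']
  rwa [mul_add, h2, mul_div_cancel₀ _ k_pos.ne'] at h1

/-- The probability that the cluster misses a point well inside the limiting shape. -/
theorem measure_notMem_cluster_le_exp {Ω : Type*} [MeasurableSpace Ω] {μ : Measure Ω}
    [IsProbabilityMeasure μ] {X : ℕ → ℕ → Ω → ℤ × ℤ} (hX : ∀ i, IsSimpleRandomWalk μ (X i))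
    (hindep : iIndepFun (fun i ω t => X i t ω) μ) {n M : ℕ} (hM : 1 ≤ M)
    {R η : ℝ} (hη : 0 < η) (hMR : M ≤ R) (hR : 4 / 9 * R ^ 3 = n)
    (hn : 4 / 9 * (M : ℝ) ^ 3 + 7 * (M : ℝ) ^ 2 ≤ n) {z : ℤ × ℤ}
    (hz : |(z.1 : ℝ)| + √(3 * |(z.2 : ℝ)|) + η * R ≤ M) :
    z ∈ region M ∧ μ {ω | z ∉ cluster (fun i t => X i t ω) n} ≤
      ENNReal.ofReal (Real.exp (-(η ^ 8 / 2304 * R))) := by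
  have hM' : (1 : ℝ) ≤ M := by exact_mod_cast hM
  have hR1 : 1 ≤ R := hM'.trans hMR
  have hs := Real.sqrt_nonneg (3 * |(z.2 : ℝ)|)
  have hs2 := Real.sq_sqrt (show 0 ≤ 3 * |(z.2 : ℝ)| by positivity)
  have hηR : 0 < η * R := by positivity
  -- Square M - |x| ≥ √(3|y|) + ηR and drop the cross term.
  have hgap : (η * R) ^ 2 / 3 ≤ gap M z := by
    rw [gap, toothLength_of_le (by linarith)]
    nlinarith
  have hgap0 : 0 < gap M z := lt_of_lt_of_le (by positivity) hgap
  have hzM := mem_region.2 hgap0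
  refine ⟨hzM, ?_⟩
  obtain ⟨H, hH⟩ := exists_isHittingFunction hzM
  have hn0 : 0 < n := by
    have : (0 : ℝ) < n := lt_of_lt_of_le (by positivity) hn
    exact_mod_cast this
  have hod : (η * R) ^ 4 / 18 ≤ odometer M z := by
    rw [odometer, tri_of_nonneg hgap0.le]
    have := mul_le_mul hgap hgap (by positivity) hgap0.le
    nlinarith
  have hd : ((M ^ 2 + M : ℕ) : ℝ) ≤ 2 * R ^ 2 := by
    push_cast
    nlinarith
  have hd0 : (0 : ℝ) < (M ^ 2 + M : ℕ) := by positivity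
  set r := odometer M z / (M ^ 2 + M : ℕ) with hr
  have hr1 : η ^ 4 * R ^ 2 / 36 ≤ r := by
    rw [hr, le_div_iff₀ hd0]
    calc η ^ 4 * R ^ 2 / 36 * (M ^ 2 + M : ℕ) ≤ η ^ 4 * R ^ 2 / 36 * (2 * R ^ 2) := by gcongr
      _ = (η * R) ^ 4 / 18 := by ring
      _ ≤ _ := hod
  have hr0 : 0 ≤ r := le_trans (by positivity) hr1
  refine (measure_notMem_cluster_le hX hindep hH hn0 hr0 (hH.sum_le hM hn hzM)).trans ?_
  refine ENNReal.ofReal_le_ofReal (Real.exp_le_exp.2 (neg_le_neg ?_))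
  rw [← hR, le_div_iff₀ (by positivity)]
  calc η ^ 8 / 2304 * R * (4 * (4 / 9 * R ^ 3)) = (η ^ 4 * R ^ 2 / 36) ^ 2 := by ring
    _ ≤ r ^ 2 := by gcongr

/-- Of the nine powers, three pay for the number of sites and six give the summable n⁻². -/
theorem eventually_exp_neg_le {c : ℝ} (hc : 0 < c) :
    ∀ᶠ R : ℝ in atTop, Real.exp (-(c * R)) ≤ 1 / R ^ 9 := by
  have h1 : Tendsto (fun R : ℝ => (c * R) ^ 9 * Real.exp (-(c * R))) atTop (nhds 0) :=
    (Real.tendsto_pow_mul_exp_neg_atTop_nhds_zero 9).comp (tendsto_id.const_mul_atTop hc)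
  filter_upwards [h1.eventually_le_const (pow_pos hc 9), eventually_gt_atTop 0] with R hR hR0
  rw [le_div_iff₀ (by positivity)]
  rw [mul_pow, mul_assoc] at hR
  have := le_of_mul_le_mul_left (hR.trans_eq (mul_one _).symm) (by positivity)
  linarith

/-- The inner bound along a single scale. -/
theorem eventually_measure_ball_subset_le {Ω : Type*} [MeasurableSpace Ω] {μ : Measure Ω}
    [IsProbabilityMeasure μ] {X : ℕ → ℕ → Ω → ℤ × ℤ} (hX : ∀ i, IsSimpleRandomWalk μ (X i))
    (hindep : iIndepFun (fun i ω t => X i t ω) μ) {ε : ℝ} (hε : 0 < ε) (hε1 : ε < 1) :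
    ∀ᶠ n : ℕ in atTop,
      μ {ω | ¬ ball ((n : ℝ) * (1 - ε)) ⊆ cluster (fun i t => X i t ω) n} ≤
        ENNReal.ofReal (15 * (1 / (n : ℝ) ^ 2)) := by
  set α : ℝ := (1 - ε) ^ (1 / 3 : ℝ) with hα
  have hα0 : 0 < α := Real.rpow_pos_of_pos (by linarith) _
  have hα1 : α < 1 := Real.rpow_lt_one (by linarith) (by linarith) (by norm_num)
  -- The ball has radius αR and M is about βR, with β midway between α and 1. Then (β - α)R = 2ηR:
  -- one ηR is the margin, the other covers rounding M down. The room 1 - β³ absorbs the error 7M².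
  set η : ℝ := (1 - α) / 4 with hη
  have hη0 : 0 < η := by rw [hη]; linarith
  have hRlim : Tendsto (fun n : ℕ => k * (n : ℝ) ^ (1 / 3 : ℝ)) atTop atTop :=
    ((tendsto_rpow_atTop (by norm_num)).comp tendsto_natCast_atTop_atTop).const_mul_atTop k_pos
  set β : ℝ := (1 + α) / 2 with hβ
  have hβ1 : β < 1 := by rw [hβ]; linarith
  have hβ0 : 0 < β := by rw [hβ]; linarith
  have hβ3 : 0 < 4 / 9 * (1 - β ^ 3) := by
    have := pow_lt_one₀ hβ0.le hβ1 (n := 3) (by norm_num)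
    linarith
  filter_upwards [hRlim.eventually_ge_atTop (1 / η), hRlim.eventually_ge_atTop (1 / β),
    hRlim.eventually_ge_atTop (7 / (4 / 9 * (1 - β ^ 3))),
    hRlim.eventually (eventually_exp_neg_le (c := η ^ 8 / 2304) (by positivity))] with n h1 h2 h3 h4
  set R := k * (n : ℝ) ^ (1 / 3 : ℝ) with hR
  have hR3 : 4 / 9 * R ^ 3 = n := by
    rw [hR, mul_pow, k_pow_three, ← Real.rpow_natCast, ← Real.rpow_mul (Nat.cast_nonneg n)]
    norm_num
    ring
  have hR0 : 0 < R := lt_of_lt_of_le (by positivity) h1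
  rw [div_le_iff₀ hη0] at h1
  rw [div_le_iff₀ hβ0] at h2
  rw [div_le_iff₀ hβ3] at h3
  set M := ⌊β * R⌋₊ with hMdef
  have hMle : (M : ℝ) ≤ β * R := Nat.floor_le (by positivity)
  have hMge : β * R - 1 < M := Nat.sub_one_lt_floor _
  have hM1 : 1 ≤ M := Nat.le_floor (by push_cast; linarith)
  have hMR : (M : ℝ) ≤ R := hMle.trans (mul_le_of_le_one_left hR0.le hβ1.le)
  have hn : 4 / 9 * (M : ℝ) ^ 3 + 7 * (M : ℝ) ^ 2 ≤ n := by
    have e1 : (M : ℝ) ^ 3 ≤ (β * R) ^ 3 := pow_le_pow_left₀ (Nat.cast_nonneg M) hMle 3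
    have e2 : (M : ℝ) ^ 2 ≤ R ^ 2 := pow_le_pow_left₀ (Nat.cast_nonneg M) hMR 2
    have e3 := mul_le_mul_of_nonneg_right h3 (sq_nonneg R)
    rw [← hR3]
    nlinarith
  have hball : ∀ z ∈ ball ((n : ℝ) * (1 - ε)),
      |(z.1 : ℝ)| + √(3 * |(z.2 : ℝ)|) + η * R ≤ M := fun z hz => by
    have := abs_add_sqrt_le_of_mem_ball hz
    rw [Real.mul_rpow (Nat.cast_nonneg n) (by linarith), ← mul_assoc] at this
    have e : β * R - 1 - (R * α) ≥ η * R := by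
      have : (β - α) * R = 2 * (η * R) := by rw [hβ, hη]; ring
      linarith
    linarith
  have hpt := fun z hz => measure_notMem_cluster_le_exp hX hindep hM1 hη0 hMR hR3 hn (hball z hz)
  classical
  set S := (region M).filter fun z => z ∈ ball ((n : ℝ) * (1 - ε)) with hS
  have hsub : {ω | ¬ ball ((n : ℝ) * (1 - ε)) ⊆ cluster (fun i t => X i t ω) n} ⊆
      ⋃ z ∈ S, {ω | z ∉ cluster (fun i t => X i t ω) n} := fun ω hω => by
    obtain ⟨z, hz, hzc⟩ := Set.not_subset.1 hω
    exact Set.mem_biUnion (Finset.mem_coe.2 (Finset.mem_filter.2 ⟨(hpt z hz).1, hz⟩)) hzc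
  refine (measure_mono hsub).trans ((measure_biUnion_finset_le _ _).trans ?_)
  refine (Finset.sum_le_card_nsmul _ _ _ fun z hz => (hpt z (Finset.mem_filter.1 hz).2).2).trans ?_
  rw [nsmul_eq_mul, ← ENNReal.ofReal_natCast, ← ENNReal.ofReal_mul (Nat.cast_nonneg _)]
  refine ENNReal.ofReal_le_ofReal ?_
  have hcard : (S.card : ℝ) ≤ 15 * R ^ 3 := by
    have : S.card ≤ 15 * M ^ 3 := (Finset.card_filter_le _ _).trans (card_region_le hM1)
    have : (S.card : ℝ) ≤ 15 * (M : ℝ) ^ 3 := by exact_mod_cast this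
    have := pow_le_pow_left₀ (Nat.cast_nonneg M) hMR 3
    linarith
  calc (S.card : ℝ) * Real.exp (-(η ^ 8 / 2304 * R)) ≤ 15 * R ^ 3 * (1 / R ^ 9) := by gcongr
    _ = 15 * (1 / (R ^ 3) ^ 2) := by field_simp
    _ ≤ 15 * (1 / (n : ℝ) ^ 2) := by
      have hn0 : (0 : ℝ) < n := by rw [← hR3]; positivity
      have : (n : ℝ) ≤ R ^ 3 := by rw [← hR3]; nlinarith [pow_pos hR0 3]
      gcongr

theorem ae_eventually_ball_subset {Ω : Type*} [MeasurableSpace Ω] {μ : Measure Ω}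
    [IsProbabilityMeasure μ] {X : ℕ → ℕ → Ω → ℤ × ℤ}
    (hX : ∀ i, IsSimpleRandomWalk μ (X i))
    (hindep : iIndepFun (fun i ω t => X i t ω) μ) {ε : ℝ} (hε : 0 < ε) (hε1 : ε < 1) :
    ∀ᵐ ω ∂μ, ∀ᶠ n : ℕ in atTop,
      ball ((n : ℝ) * (1 - ε)) ⊆ cluster (fun i t => X i t ω) n := by
  obtain ⟨N, hN⟩ := eventually_atTop.1 (eventually_measure_ball_subset_le hX hindep hε hε1)
  set s : ℕ → Set Ω := fun n =>
    {ω | N ≤ n ∧ ¬ ball ((n : ℝ) * (1 - ε)) ⊆ cluster (fun i t => X i t ω) n} with hs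
  have hle : ∀ n, μ (s n) ≤ ENNReal.ofReal (15 * (1 / (n : ℝ) ^ 2)) := fun n => by
    by_cases h : N ≤ n
    · exact (measure_mono fun ω hω => hω.2).trans (hN n h)
    · have : s n = ∅ := Set.eq_empty_of_forall_notMem fun ω hω => h hω.1
      simp [this]
  have hsum : ∑' n, μ (s n) ≠ ⊤ := ne_top_of_le_ne_top
    ((Real.summable_one_div_nat_pow.2 one_lt_two).mul_left 15).tsum_ofReal_ne_top
    (ENNReal.tsum_le_tsum hle)
  filter_upwards [ae_eventually_notMem hsum] with ω hω
  filter_upwards [hω, eventually_ge_atTop N] with n h1 h2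
  by_contra h
  exact h1 ⟨h2, h⟩

end CombIDLA

theorem theorem4p2 {Ω : Type*} [MeasurableSpace Ω] (μ : Measure Ω) [IsProbabilityMeasure μ]
    (X : ℕ → ℕ → Ω → ℤ × ℤ)
    (hX : ∀ i, CombIDLA.IsSimpleRandomWalk μ (X i))
    (hindep : iIndepFun (fun i ω t => X i t ω) μ)
    (ε : ℝ) (hε : 0 < ε) :
    ∀ᵐ ω ∂μ, ∀ᶠ n : ℕ in atTop,
      CombIDLA.ball ((n : ℝ) * (1 - ε)) ⊆ CombIDLA.cluster (fun i t => X i t ω) n := by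
  -- Shrinking ε enlarges the ball and keeps 1 - ε positive.
  have h := CombIDLA.ae_eventually_ball_subset hX hindep (ε := min ε (1 / 2))
    (lt_min hε (by norm_num)) ((min_le_right _ _).trans_lt (by norm_num))
  filter_upwards [h] with ω hω
  filter_upwards [hω] with n hn
  exact (CombIDLA.ball_mono (mul_le_mul_of_nonneg_left
    (sub_le_sub_left (min_le_left _ _) 1) (Nat.cast_nonneg n))).trans hn
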